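/- Let $\mathcal C=(\mathcal C,\mathbb E,\mathfrak s)$ be an extriangulated category (in the sense of Nakaoka–Palu) with higher extension groups: either $\mathcal C$ is abelian or triangulated with its standard extriangulated structure, and $\mathbb E^k(X,Y)$ is $\mathrm{Ext}^k(X,Y)$, respectively $\mathrm{Hom}(X,Y[k])$; or $\mathcal C$ has enough $\mathbb E$-projectives and enough $\mathbb E$-injectives, and $\mathbb E^{k}(X,Y)=\mathbb E(X,\Sigma^{k-1}Y)$, where $\Sigma^{j}Y$ is a $j$-th cosyzygy of $Y$ ($k\ge 1$). "Subcategory" means full subcategory, or class of objects. For classes of objects $\mathcal X,\mathcal Y,\omega$ in $\mathcal C$: * $\mathcal X$ is *left thick* (*right thick*) if it is closed under extensions, direct summands in $\mathcal C$ and cocones (respectively cones) of conflations; it is *thick* if it is both; $\mathsf{Thick}(\mathcal X)$ is the smallest thick class containing $\mathcal X$. * $\mathcal X^\wedge$ is the class of objects $C$ with a finite resolution $0\to X_n\to\cdots\to X_0\to C\to 0$ with all $X_i\in\mathcal X$, i.e. with conflations $Z_{i+1}\to X_i\to Z_i$ for $0\le i<n$, where $Z_0=C$ and $Z_n\simeq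 X_n$. * $\mathrm{id}_{\mathcal X}(\mathcal Y)=0$ means $\mathbb E^k(X,Y)=0$ for all $k\ge1$, $X\in\mathcal X$, $Y\in\mathcal Y$. * $\omega$ is a *relative cogenerator* in $\mathcal X$ if $\omega\subseteq\mathcal X$ and every $X\in\mathcal X$ has a conflation $X\to W\to X'$ with $W\in\omega$, $X'\in\mathcal X$; *relative generators* are defined dually, by conflations $X'\to W\to X$. * $(\mathcal X,\omega)$ is a *left Frobenius pair* if $\mathcal X$ is left thick, $\omega$ is closed under direct summands, $\mathrm{id}_{\mathcal X}(\omega)=0$ and $\omega$ is a relative cogenerator in $\mathcal X$. Let $\mathcal S\subseteq\mathcal C$ be a thick subcategory. * $(\mathcal X,\omega)$ is a *left Frobenius pair cut on $\mathcal S$* if $\mathcal X$ is left thick, $(\mathcal X\cap\mathcal S,\omega\cap\mathcal S)$ is a left Frobenius pair, $\omega\cap\mathcal S$ is a relative generator in $\omega$ with $\mathbb E^k(\omega\cap\mathcal S,\omega)=0$ for all $k\ge1$, and $\omega$ is closed under extensions and direct summands. * $\mathfrak C_{\mathcal S}$ is the class of *left weak AB contexts cut on $\mathcal S$*: the pairs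 $(\mathcal A,\mathcal B)$ of classes of objects such that $(\mathcal A,\mathcal A\cap\mathcal B)$ is a left Frobenius pair cut on $\mathcal S$, $\mathcal B\cap\mathcal S$ is right thick, and $\mathcal B\cap\mathcal S\subseteq(\mathcal A\cap\mathcal S)^\wedge$. * $(\mathcal F,\mathcal G)$ is a *$1$-cotorsion pair cut on a class $\mathcal T$* if $\mathcal F$ and $\mathcal G$ are closed under direct summands, $\mathbb E(\mathcal F\cap\mathcal T,\mathcal G)=0=\mathbb E(\mathcal F,\mathcal G\cap\mathcal T)$, and every $T\in\mathcal T$ has conflations $G\to F\to T$ and $T\to G'\to F'$ with $F,F'\in\mathcal F$ and $G,G'\in\mathcal G$. * $\widetilde{\mathfrak P}_{\mathcal S}$ is the class of pairs $(\mathcal F,\mathcal G)$ of classes of objects such that $(\mathcal F,\mathcal G)$ is a $1$-cotorsion pair cut on $\mathsf{Thick}(\mathcal F)$, $\mathrm{id}_{\mathcal F}(\mathcal G)=0$, $\mathcal F\cap\mathcal G\cap\mathcal S$ is both a relative generator and a relative cogenerator in $\mathcal F\cap\mathcal G$, and $\mathcal G\subseteq\mathsf{Thick}(\mathcal F)$.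 On each of $\widetilde{\mathfrak P}_{\mathcal S}$ and $\mathfrak C_{\mathcal S}$ write $(\mathcal U,\mathcal V)\sim(\mathcal U',\mathcal V')$ if $\mathcal U\cap\mathcal S=\mathcal U'\cap\mathcal S$ and $\mathcal U\cap\mathcal V\cap\mathcal S=\mathcal U'\cap\mathcal V'\cap\mathcal S$, and write $[\mathcal U,\mathcal V]$ for the equivalence class. **Corollary.** The correspondence $\widetilde{\mathfrak P}_{\mathcal S}/\!\sim\ \to\ \mathfrak C_{\mathcal S}/\!\sim$, $[\mathcal F,\mathcal G]\mapsto[\mathcal F,\mathcal G]$, is well defined and bijective, and its inverse is the (well-defined) map $[\mathcal A,\mathcal B]\mapsto[\mathcal A\cap\mathcal S,\mathcal B\cap\mathcal S]$. -/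

import Mathlib

open CategoryTheory CategoryTheory.Limits Opposite

universe w v u

/-! ## Extriangulated categories -/

section Bifunctor

variable {C : Type u} [Category.{v} C]

/-- The group `𝔼(Z, A)` of `𝔼`-extensions of `Z` by `A`. -/
abbrev ExtGroup (E : Cᵒᵖ ⥤ C ⥤ AddCommGrpCat.{w}) (Z A : C) : Type w :=
  ((E.obj (op Z)).obj A : AddCommGrpCat.{w})

/-- `a δ := 𝔼(Z, a)(δ)`. -/
def extPush (E : Cᵒᵖ ⥤ C ⥤ AddCommGrpCat.{w}) {Z A A' : C} (a : A ⟶ A') :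
    ExtGroup E Z A →+ ExtGroup E Z A' :=
  ((E.obj (op Z)).map a).hom

/-- `δ c := 𝔼(c, A)(δ)`. -/
def extPull (E : Cᵒᵖ ⥤ C ⥤ AddCommGrpCat.{w}) {Z Z' A : C} (c : Z' ⟶ Z) :
    ExtGroup E Z A →+ ExtGroup E Z' A :=
  ((E.map c.op).app A).hom

/-- `δ ⊕ δ'`, the element of `𝔼(Z ⊕ Z', A ⊕ A')` with components `(δ, 0, 0, δ')`. -/
noncomputable def extSum [Preadditive C] [HasBinaryBiproducts C]
    (E : Cᵒᵖ ⥤ C ⥤ AddCommGrpCat.{w}) {Z Z' A A' : C}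
    (δ : ExtGroup E Z A) (δ' : ExtGroup E Z' A') : ExtGroup E (Z ⊞ Z') (A ⊞ A') :=
  extPull E (biprod.fst : Z ⊞ Z' ⟶ Z) (extPush E (biprod.inl : A ⟶ A ⊞ A') δ) +
    extPull E (biprod.snd : Z ⊞ Z' ⟶ Z') (extPush E (biprod.inr : A' ⟶ A ⊞ A') δ')

end Bifunctor

/-- An external triangulation `(𝔼, 𝔰)` of an additive category `C`. The realization `𝔰` is encoded
by the relation `Realizes x y δ`, meaning `𝔰(δ) = [A ⟶ B ⟶ Z]`; the fields `exists_realizes` and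
`realizes_iff` say that `{(x, y) | Realizes x y δ}` is exactly one equivalence class. -/
structure Extriangulation (C : Type u) [Category.{v} C] [Preadditive C]
    [HasBinaryBiproducts C] where
  /-- (ET1) the biadditive functor `𝔼` -/
  E : Cᵒᵖ ⥤ C ⥤ AddCommGrpCat.{w}
  additive_left : E.Additive
  additive_right : ∀ Z : Cᵒᵖ, (E.obj Z).Additive
  /-- the sequence `A ⟶ B ⟶ Z` realizes `δ` -/
  Realizes : ∀ {A B Z : C}, (A ⟶ B) → (B ⟶ Z) → ExtGroup E Z A → Prop
  exists_realizes : ∀ {A Z : C} (δ : ExtGroup E Z A),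
    ∃ (B : C) (x : A ⟶ B) (y : B ⟶ Z), Realizes x y δ
  realizes_iff : ∀ {A B B' Z : C} {δ : ExtGroup E Z A} {x : A ⟶ B} {y : B ⟶ Z}
    (x' : A ⟶ B') (y' : B' ⟶ Z), Realizes x y δ →
      (Realizes x' y' δ ↔ ∃ b : B ≅ B', x ≫ b.hom = x' ∧ b.hom ≫ y' = y)
  /-- `𝔰` is a realization: morphisms of extensions are realized -/
  lift : ∀ {A B Z A' B' Z' : C} {x : A ⟶ B} {y : B ⟶ Z} {δ : ExtGroup E Z A}
    {x' : A' ⟶ B'} {y' : B' ⟶ Z'} {δ' : ExtGroup E Z' A'},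
    Realizes x y δ → Realizes x' y' δ' → ∀ (a : A ⟶ A') (c : Z ⟶ Z'),
      extPush E a δ = extPull E c δ' → ∃ b : B ⟶ B', x ≫ b = a ≫ x' ∧ y ≫ c = b ≫ y'
  /-- (ET2) `𝔰` is additive -/
  realizes_zero : ∀ A Z : C,
    Realizes (biprod.inl : A ⟶ A ⊞ Z) (biprod.snd : A ⊞ Z ⟶ Z) (0 : ExtGroup E Z A)
  realizes_sum : ∀ {A B Z A' B' Z' : C} {x : A ⟶ B} {y : B ⟶ Z} {δ : ExtGroup E Z A}
    {x' : A' ⟶ B'} {y' : B' ⟶ Z'} {δ' : ExtGroup E Z' A'},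
    Realizes x y δ → Realizes x' y' δ' →
      Realizes (biprod.map x x') (biprod.map y y') (extSum E δ δ')
  /-- (ET3) -/
  et3 : ∀ {A B Z A' B' Z' : C} {x : A ⟶ B} {y : B ⟶ Z} {δ : ExtGroup E Z A}
    {x' : A' ⟶ B'} {y' : B' ⟶ Z'} {δ' : ExtGroup E Z' A'},
    Realizes x y δ → Realizes x' y' δ' → ∀ (a : A ⟶ A') (b : B ⟶ B'), x ≫ b = a ≫ x' →
      ∃ c : Z ⟶ Z', y ≫ c = b ≫ y' ∧ extPush E a δ = extPull E c δ'
  /-- the dual of (ET3) -/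
  et3_op : ∀ {A B Z A' B' Z' : C} {x : A ⟶ B} {y : B ⟶ Z} {δ : ExtGroup E Z A}
    {x' : A' ⟶ B'} {y' : B' ⟶ Z'} {δ' : ExtGroup E Z' A'},
    Realizes x y δ → Realizes x' y' δ' → ∀ (b : B ⟶ B') (c : Z ⟶ Z'), y ≫ c = b ≫ y' →
      ∃ a : A ⟶ A', x ≫ b = a ≫ x' ∧ extPush E a δ = extPull E c δ'
  /-- (ET4) -/
  et4 : ∀ {A B D M F : C} {f : A ⟶ B} {f' : B ⟶ D} {δ : ExtGroup E D A}
    {g : B ⟶ M} {g' : M ⟶ F} {δ' : ExtGroup E F B},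
    Realizes f f' δ → Realizes g g' δ' →
      ∃ (N : C) (d : D ⟶ N) (e : N ⟶ F) (h : A ⟶ M) (h' : M ⟶ N) (δ'' : ExtGroup E N A),
        f ≫ g = h ∧ f' ≫ d = g ≫ h' ∧ h' ≫ e = g' ∧
        Realizes h h' δ'' ∧ Realizes d e (extPush E f' δ') ∧
        extPull E d δ'' = δ ∧ extPush E f δ'' = extPull E e δ'
  /-- the dual of (ET4) -/
  et4_op : ∀ {D A B F M : C} {f' : D ⟶ A} {f : A ⟶ B} {δ : ExtGroup E B D}
    {g' : F ⟶ B} {g : B ⟶ M} {δ' : ExtGroup E M F},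
    Realizes f' f δ → Realizes g' g δ' →
      ∃ (N : C) (d : D ⟶ N) (e : N ⟶ F) (h' : N ⟶ A) (h : A ⟶ M) (δ'' : ExtGroup E M N),
        d ≫ h' = f' ∧ e ≫ g' = h' ≫ f ∧ f ≫ g = h ∧
        Realizes h' h δ'' ∧ Realizes d e (extPull E g' δ) ∧
        extPush E e δ'' = δ' ∧ extPush E d δ = extPull E g δ''

namespace Extriangulation

section Basic

variable {C : Type u} [Category.{v} C] [Preadditive C] [HasBinaryBiproducts C]
  (T : Extriangulation.{w} C)

/-- `A ⟶ B ⟶ Z` is a conflation, i.e. it is part of an `𝔼`-triangle. -/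
def Conflation {A B Z : C} (x : A ⟶ B) (y : B ⟶ Z) : Prop :=
  ∃ δ : ExtGroup T.E Z A, T.Realizes x y δ

/-- There is a conflation `A ⟶ B ⟶ Z`. -/
def HasConflation (A B Z : C) : Prop :=
  ∃ (x : A ⟶ B) (y : B ⟶ Z), T.Conflation x y

/-- `Cone(X, Y)`: the objects `Z` with a conflation `A ⟶ B ⟶ Z`, `A ∈ X`, `B ∈ Y`. -/
def cone (X Y : ObjectProperty C) : ObjectProperty C :=
  fun Z => ∃ A B : C, X A ∧ Y B ∧ T.HasConflation A B Z

/-- `CoCone(X, Y)`: the objects `A` with a conflation `A ⟶ B ⟶ Z`, `B ∈ X`, `Z ∈ Y`. -/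
def cocone (X Y : ObjectProperty C) : ObjectProperty C :=
  fun A => ∃ B Z : C, X B ∧ Y Z ∧ T.HasConflation A B Z

def ClosedUnderExtensions (X : ObjectProperty C) : Prop :=
  ∀ ⦃A B Z : C⦄, T.HasConflation A B Z → X A → X Z → X B

def ClosedUnderCones (X : ObjectProperty C) : Prop := T.cone X X ≤ X

def ClosedUnderCocones (X : ObjectProperty C) : Prop := T.cocone X X ≤ X

/-- Closed under direct summands in `C`: if `A ⊕ B ≅ Z` and `Z ∈ X`, then `A ∈ X`. -/
def ClosedUnderSummands (X : ObjectProperty C) : Prop :=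
  ∀ ⦃A B Z : C⦄, Nonempty (A ⊞ B ≅ Z) → X Z → X A

structure IsLeftThick (X : ObjectProperty C) : Prop where
  extensions : T.ClosedUnderExtensions X
  summands : ClosedUnderSummands X
  cocones : T.ClosedUnderCocones X

structure IsRightThick (X : ObjectProperty C) : Prop where
  extensions : T.ClosedUnderExtensions X
  summands : ClosedUnderSummands X
  cones : T.ClosedUnderCones X

def IsThick (X : ObjectProperty C) : Prop := T.IsLeftThick X ∧ T.IsRightThick X

/-- `Thick(X)`, the smallest thick subcategory containing `X`. -/
def thick (X : ObjectProperty C) : ObjectProperty C :=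
  fun Z => ∀ P : ObjectProperty C, T.IsThick P → X ≤ P → P Z

/-- The objects `Z` with a finite `X`-resolution `0 ⟶ X_n ⟶ ⋯ ⟶ X_0 ⟶ Z ⟶ 0` of length `n`, that is,
with conflations `Z_{i+1} ⟶ X_i ⟶ Z_i` for `i < n`, where `Z_0 = Z` and `Z_n ≅ X_n`. -/
def hasResolution (X : ObjectProperty C) : ℕ → ObjectProperty C
  | 0 => X.isoClosure
  | n + 1 => T.cone (hasResolution X n) X

/-- The dual notion: finite `X`-coresolutions of length `n`. -/
def hasCoresolution (X : ObjectProperty C) : ℕ → ObjectProperty C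
  | 0 => X.isoClosure
  | n + 1 => T.cocone X (hasCoresolution X n)

/-- The class of objects with `X`-resolution dimension at most `n`. -/
def resDimLE (X : ObjectProperty C) (n : ℕ) : ObjectProperty C :=
  fun Z => ∃ m ≤ n, T.hasResolution X m Z

/-- The class of objects with `X`-coresolution dimension at most `n`. -/
def coresDimLE (X : ObjectProperty C) (n : ℕ) : ObjectProperty C :=
  fun Z => ∃ m ≤ n, T.hasCoresolution X m Z

/-- `X^∧`, the objects of finite `X`-resolution dimension. -/
def finResDim (X : ObjectProperty C) : ObjectProperty C :=
  fun Z => ∃ n : ℕ, T.resDimLE X n Z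

/-- `ω` is a relative generator in `X`. -/
def IsRelGenerator (ω X : ObjectProperty C) : Prop :=
  ω ≤ X ∧ ∀ A : C, X A → ∃ A' W : C, X A' ∧ ω W ∧ T.HasConflation A' W A

/-- `ω` is a relative cogenerator in `X`. -/
def IsRelCogenerator (ω X : ObjectProperty C) : Prop :=
  ω ≤ X ∧ ∀ A : C, X A → ∃ W A' : C, ω W ∧ X A' ∧ T.HasConflation A W A'

/-- The class of `𝔼`-projective objects. -/
def projectives : ObjectProperty C :=
  fun P => ∀ ⦃A B Z : C⦄ (x : A ⟶ B) (y : B ⟶ Z), T.Conflation x y →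
    ∀ f : P ⟶ Z, ∃ g : P ⟶ B, g ≫ y = f

/-- The class of `𝔼`-injective objects. -/
def injectives : ObjectProperty C :=
  fun I => ∀ ⦃A B Z : C⦄ (x : A ⟶ B) (y : B ⟶ Z), T.Conflation x y →
    ∀ f : A ⟶ I, ∃ g : B ⟶ I, x ≫ g = f

def EnoughProj : Prop := ∀ Z : C, ∃ A P : C, T.projectives P ∧ T.HasConflation A P Z

def EnoughInj : Prop := ∀ A : C, ∃ I Z : C, T.injectives I ∧ T.HasConflation A I Z

/-- The class `Σ^k Y` of `k`-th cosyzygies of an object `Y`. -/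
def cosyzygy (Y : C) : ℕ → ObjectProperty C
  | 0 => fun Z => Z = Y
  | k + 1 => T.cone (cosyzygy Y k) T.injectives

end Basic

/-! ## Higher extension groups -/

/-- The ways in which an extriangulated category can have higher extension groups.
* `abelian`: `C` is an abelian category with its standard extriangulated structure, the one whose
  conflations are the short exact sequences (this forces `𝔼 ≅ Ext¹`, as each conflation then
  realizes a unique extension);
* `triangulated`: `C` is a triangulated category with its standard extriangulated structure, the
  one with `𝔼 = Hom(-, -[1])`, realized by the distinguished triangles;
* `enough`: there are enough `𝔼`-projectives and enough `𝔼`-injectives. -/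
inductive HigherExtensions {C : Type u} [Category.{v} C] [Preadditive C] [HasZeroObject C]
    [HasBinaryBiproducts C] (T : Extriangulation.{w} C) : Type (max u v w)
  | abelian (normalMono : IsNormalMonoCategory C) (normalEpi : IsNormalEpiCategory C)
      (kernels : HasKernels C) (cokernels : HasCokernels C)
      (conflation_iff : ∀ {A B Z : C} (x : A ⟶ B) (y : B ⟶ Z),
        T.Conflation x y ↔ ∃ zero : x ≫ y = 0, (ShortComplex.mk x y zero).ShortExact)
  | triangulated (shift : HasShift C ℤ) (additive : ∀ n : ℤ, (shiftFunctor C n).Additive)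
      (pretriangulated : Pretriangulated C) (octahedron : IsTriangulated C)
      (φ : ∀ Z A : C, ExtGroup T.E Z A ≃+ (Z ⟶ A⟦(1 : ℤ)⟧))
      (φ_push : ∀ {Z A A' : C} (a : A ⟶ A') (δ : ExtGroup T.E Z A),
        φ Z A' (extPush T.E a δ) = φ Z A δ ≫ (shiftFunctor C (1 : ℤ)).map a)
      (φ_pull : ∀ {Z Z' A : C} (c : Z' ⟶ Z) (δ : ExtGroup T.E Z A),
        φ Z' A (extPull T.E c δ) = c ≫ φ Z A δ)
      (realizes_iff : ∀ {A B Z : C} (x : A ⟶ B) (y : B ⟶ Z) (δ : ExtGroup T.E Z A),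
        T.Realizes x y δ ↔
          Pretriangulated.Triangle.mk x y (φ Z A δ) ∈ Pretriangulated.distinguishedTriangles)
  | enough (proj : T.EnoughProj) (inj : T.EnoughInj)

namespace HigherExtensions

variable {C : Type u} [Category.{v} C] [Preadditive C] [HasZeroObject C] [HasBinaryBiproducts C]
  {T : Extriangulation.{w} C}

/-- `𝔼^k(X, Y) = 0`, for `k ≥ 1`. Here `𝔼^k(X, Y)` is `Ext^k(X, Y)` in the abelian case,
`Hom(X, Y[k])` in the triangulated case, and `𝔼(X, Σ^{k-1} Y)` if there are enough projectives and
injectives (up to isomorphism, this does not depend on the cosyzygy). -/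
def ExtVanishes : T.HigherExtensions → ℕ → C → C → Prop
  | .abelian normalMono normalEpi kernels cokernels _, k, X, Y =>
      letI : Abelian C :=
        { (inferInstance : Preadditive C) with
          toIsNormalMonoCategory := normalMono
          toIsNormalEpiCategory := normalEpi
          has_finite_products := hasFiniteProducts_of_has_binary_and_terminal
          has_kernels := kernels
          has_cokernels := cokernels }
      letI : HasExt.{max u v} C := HasExt.standard C
      Subsingleton (Abelian.Ext.{max u v} X Y k)
  | .triangulated _ _ _ _ _ _ _ _, k, X, Y => Subsingleton (X ⟶ Y⟦(k : ℤ)⟧)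
  | .enough _ _, k, X, Y => ∀ Z : C, T.cosyzygy Y (k - 1) Z → Subsingleton (ExtGroup T.E X Z)

variable (H : T.HigherExtensions)

/-- `𝔼^k(X, Y) = 0` for classes of objects `X` and `Y`. -/
def ClassExtVanishes (k : ℕ) (X Y : ObjectProperty C) : Prop :=
  ∀ ⦃A B : C⦄, X A → Y B → H.ExtVanishes k A B

/-- The relative injective dimension `id_X(B) = min {m ≥ 0 : 𝔼^{≥ m + 1}(X, B) = 0}`. -/
noncomputable def relInjDimObj (X : ObjectProperty C) (B : C) : ℕ∞ :=
  sInf {d : ℕ∞ | ∃ m : ℕ, d = m ∧ ∀ k : ℕ, m + 1 ≤ k → ∀ A : C, X A → H.ExtVanishes k A B}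

/-- The relative injective dimension `id_X(Y)` of a class `Y`. -/
noncomputable def relInjDim (X Y : ObjectProperty C) : ℕ∞ :=
  ⨆ (B : C) (_ : Y B), H.relInjDimObj X B

/-- The relative projective dimension `pd_X(A) = min {m ≥ 0 : 𝔼^{≥ m + 1}(A, X) = 0}`. -/
noncomputable def relProjDimObj (X : ObjectProperty C) (A : C) : ℕ∞ :=
  sInf {d : ℕ∞ | ∃ m : ℕ, d = m ∧ ∀ k : ℕ, m + 1 ≤ k → ∀ B : C, X B → H.ExtVanishes k A B}

/-- The relative projective dimension `pd_X(Y)` of a class `Y`. -/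
noncomputable def relProjDim (X Y : ObjectProperty C) : ℕ∞ :=
  ⨆ (A : C) (_ : Y A), H.relProjDimObj X A

/-! ## Frobenius pairs, AB contexts, cotorsion pairs -/

/-- `(X, ω)` is a left Frobenius pair. -/
structure IsLeftFrobenius (X ω : ObjectProperty C) : Prop where
  leftThick : T.IsLeftThick X
  summands : ClosedUnderSummands ω
  injective : H.relInjDim X ω = 0
  cogenerator : T.IsRelCogenerator ω X

/-- `(X, ω)` is a left Frobenius pair cut on `S`. -/
structure IsLeftFrobeniusCut (S X ω : ObjectProperty C) : Prop where
  leftThick : T.IsLeftThick X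
  frobenius : H.IsLeftFrobenius (X ⊓ S) (ω ⊓ S)
  projective : H.relProjDim ω (ω ⊓ S) = 0
  generator : T.IsRelGenerator (ω ⊓ S) ω
  extensions : T.ClosedUnderExtensions ω
  summands : ClosedUnderSummands ω

/-- `(A, B)` is a left weak AB context cut on `S`. -/
structure IsLeftWeakABContextCut (S A B : ObjectProperty C) : Prop where
  frobenius : H.IsLeftFrobeniusCut S A (A ⊓ B)
  rightThick : T.IsRightThick (B ⊓ S)
  le_finResDim : B ⊓ S ≤ T.finResDim (A ⊓ S)

/-- `(A, B)` is a left `n`-cotorsion pair cut on `S` (`n ≥ 1`). -/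
structure IsLeftCotorsionCut (n : ℕ) (S A B : ObjectProperty C) : Prop where
  summands : ClosedUnderSummands A
  vanish : ∀ i : ℕ, 1 ≤ i → i ≤ n → H.ClassExtVanishes i (A ⊓ S) B
  complete : ∀ Z : C, S Z → ∃ K M : C,
    A M ∧ T.resDimLE B (n - 1) K ∧ T.HasConflation K M Z

/-- `(A, B)` is a right `n`-cotorsion pair cut on `S` (`n ≥ 1`). -/
structure IsRightCotorsionCut (n : ℕ) (S A B : ObjectProperty C) : Prop where
  summands : ClosedUnderSummands B
  vanish : ∀ i : ℕ, 1 ≤ i → i ≤ n → H.ClassExtVanishes i A (B ⊓ S)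
  complete : ∀ Z : C, S Z → ∃ M K : C,
    B M ∧ T.coresDimLE A (n - 1) K ∧ T.HasConflation Z M K

/-- `(A, B)` is an `n`-cotorsion pair cut on `S` (`n ≥ 1`). -/
def IsCotorsionCut (n : ℕ) (S A B : ObjectProperty C) : Prop :=
  H.IsLeftCotorsionCut n S A B ∧ H.IsRightCotorsionCut n S A B

/-- `(F, G)` belongs to `𝔓_S`. -/
structure MemP (S F G : ObjectProperty C) : Prop where
  cotorsion : H.IsCotorsionCut 1 (T.thick F) F G
  injective : H.relInjDim F G = 0
  generator : T.IsRelGenerator (F ⊓ G ⊓ S) (F ⊓ G)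
  cogenerator : T.IsRelCogenerator (F ⊓ G ⊓ S) (F ⊓ G)

/-- `(F, G)` belongs to `𝔓̃_S`. -/
structure MemPTilde (S F G : ObjectProperty C) : Prop extends H.MemP S F G where
  le_thick : G ≤ T.thick F

/-- The class `𝔓̃_S`. -/
def PTilde (S : ObjectProperty C) : Type u :=
  {p : ObjectProperty C × ObjectProperty C // H.MemPTilde S p.1 p.2}

/-- The class `ℭ_S` of left weak AB contexts cut on `S`. -/
def ABContext (S : ObjectProperty C) : Type u :=
  {p : ObjectProperty C × ObjectProperty C // H.IsLeftWeakABContextCut S p.1 p.2}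

/-- `(F, G) ∼ (F', G')` if `F ∩ S = F' ∩ S` and `F ∩ G ∩ S = F' ∩ G' ∩ S`. -/
instance PTilde.setoid (S : ObjectProperty C) : Setoid (H.PTilde S) where
  r p q := p.1.1 ⊓ S = q.1.1 ⊓ S ∧ p.1.1 ⊓ p.1.2 ⊓ S = q.1.1 ⊓ q.1.2 ⊓ S
  iseqv := ⟨fun _ => ⟨rfl, rfl⟩, fun h => ⟨h.1.symm, h.2.symm⟩,
    fun h h' => ⟨h.1.trans h'.1, h.2.trans h'.2⟩⟩

/-- `(A, B) ∼ (A', B')` if `A ∩ S = A' ∩ S` and `A ∩ B ∩ S = A' ∩ B' ∩ S`. -/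
instance ABContext.setoid (S : ObjectProperty C) : Setoid (H.ABContext S) where
  r p q := p.1.1 ⊓ S = q.1.1 ⊓ S ∧ p.1.1 ⊓ p.1.2 ⊓ S = q.1.1 ⊓ q.1.2 ⊓ S
  iseqv := ⟨fun _ => ⟨rfl, rfl⟩, fun h => ⟨h.1.symm, h.2.symm⟩,
    fun h h' => ⟨h.1.trans h'.1, h.2.trans h'.2⟩⟩

/-- The equivalence class `[F, G]` in `𝔓̃_S / ∼`. -/
def PTilde.cls {S F G : ObjectProperty C} (h : H.MemPTilde S F G) :
    Quotient (PTilde.setoid H S) :=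
  Quotient.mk _ ⟨(F, G), h⟩

/-- The equivalence class `[A, B]` in `ℭ_S / ∼`. -/
def ABContext.cls {S A B : ObjectProperty C} (h : H.IsLeftWeakABContextCut S A B) :
    Quotient (ABContext.setoid H S) :=
  Quotient.mk _ ⟨(A, B), h⟩

end HigherExtensions

end Extriangulation

/-! Both maps come from maps on pairs: the identity in one direction, intersection with `S` in the
other. Intersecting with `S` changes neither of the two classes that define `∼`, so once each map is
known to land in its target, well-definedness and bijectivity are formal.

From cotorsion pairs to contexts: completeness yields F = ⊥G ∩ Thick(F) and G = F⊥ ∩ Thick(F), where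
⊥ refers to all positive degrees. Hence F is left thick and G right thick. Composing approximations
with the relative (co)generator F ∩ G ∩ S moves middle terms into S. Each object of Thick(F) has
zero extensions into G in high degrees, and dimension shifting turns this bound into a finite (F ∩
S)-resolution of any object of G ∩ S.

From contexts to cotorsion pairs: put F = A ∩ S, ω = A ∩ B ∩ S, let R be the smallest right thick
class containing ω, and let D consist of the Z with a conflation Z → Y → M, where Y ∈ R and M ∈ F.
Equivalently (`cocone_iff_cone`) there is a conflation Y → M → Z of the same kind. The class D is
thick (`isThick_cocone`), so it contains Thick(F); moreover R = B ∩ S. The two descriptions of D are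
then exactly the two approximations required.

Higher extensions enter only through the exactness properties collected in `VanishingTheory`,
checked separately in the abelian, triangulated and enough-projectives-and-injectives settings. -/

section Bifunctor

variable {C : Type u} [Category.{v} C] (E : Cᵒᵖ ⥤ C ⥤ AddCommGrpCat.{w})

theorem extPush_id {Z A : C} (δ : ExtGroup E Z A) : extPush E (𝟙 A) δ = δ := by
  simp [extPush]

theorem extPush_comp {Z A A' A'' : C} (a : A ⟶ A') (a' : A' ⟶ A'') (δ : ExtGroup E Z A) :
    extPush E (a ≫ a') δ = extPush E a' (extPush E a δ) := by
  simp [extPush]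

theorem extPull_id {Z A : C} (δ : ExtGroup E Z A) : extPull E (𝟙 Z) δ = δ := by
  simp [extPull]

theorem extPull_comp {Z Z' Z'' A : C} (c : Z'' ⟶ Z') (c' : Z' ⟶ Z) (δ : ExtGroup E Z A) :
    extPull E (c ≫ c') δ = extPull E c (extPull E c' δ) := by
  simp [extPull]

theorem extPush_extPull {Z Z' A A' : C} (a : A ⟶ A') (c : Z' ⟶ Z) (δ : ExtGroup E Z A) :
    extPush E a (extPull E c δ) = extPull E c (extPush E a δ) := by
  exact (ConcreteCategory.congr_hom ((E.map c.op).naturality a) δ).symm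

end Bifunctor

namespace Extriangulation

/-! ### Exact sequences attached to a conflation -/

section Exactness

variable {C : Type u} [Category.{v} C] [Preadditive C] [HasBinaryBiproducts C]
  (T : Extriangulation.{w} C)

theorem extPush_sub {Z A A' : C} (a b : A ⟶ A') (δ : ExtGroup T.E Z A) :
    extPush T.E (a - b) δ = extPush T.E a δ - extPush T.E b δ := by
  have := T.additive_right (op Z)
  simp only [extPush, Functor.map_sub]
  rfl

theorem extPull_sub {Z Z' A : C} (a b : Z' ⟶ Z) (δ : ExtGroup T.E Z A) :
    extPull T.E (a - b) δ = extPull T.E a δ - extPull T.E b δ := by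
  have := T.additive_left
  simp only [extPull, op_sub, Functor.map_sub, NatTrans.app_sub]
  rfl

variable {T}
variable {A B Z : C} {x : A ⟶ B} {y : B ⟶ Z} {δ : ExtGroup T.E Z A}

/-- When f δ = 0, the pair (f, 𝟙) is a morphism from δ to the split extension; realize it and
project to Y. -/
theorem Realizes.exists_extend (h : T.Realizes x y δ) {Y : C} (f : A ⟶ Y)
    (hf : extPush T.E f δ = 0) : ∃ g : B ⟶ Y, x ≫ g = f := by
  obtain ⟨b, hb, -⟩ := T.lift h (T.realizes_zero Y Z) f (𝟙 Z) (by simp [hf])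
  exact ⟨b ≫ biprod.fst, by rw [reassoc_of% hb]; simp⟩

theorem Realizes.exists_lift (h : T.Realizes x y δ) {W : C} (f : W ⟶ Z)
    (hf : extPull T.E f δ = 0) : ∃ g : W ⟶ B, g ≫ y = f := by
  obtain ⟨b, -, hb⟩ := T.lift (T.realizes_zero A W) h (𝟙 A) f (by simp [hf])
  exact ⟨biprod.inr ≫ b, by rw [Category.assoc, ← hb]; simp⟩

/-- The vanishing lifts y to the middle term of a realization of ε; dual (ET3) completes the lift to
a morphism of extensions over the identity of Z. -/
theorem Realizes.exists_eq_extPush (h : T.Realizes x y δ) {Y : C} (ε : ExtGroup T.E Z Y)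
    (hε : extPull T.E y ε = 0) : ∃ f : A ⟶ Y, extPush T.E f δ = ε := by
  obtain ⟨M, x', y', h'⟩ := T.exists_realizes ε
  obtain ⟨b, hb⟩ := h'.exists_lift y hε
  obtain ⟨a, -, ha⟩ := T.et3_op h h' b (𝟙 Z) (by simp [hb])
  exact ⟨a, by rw [ha, extPull_id]⟩

theorem Realizes.exists_eq_extPull (h : T.Realizes x y δ) {W : C} (ε : ExtGroup T.E W A)
    (hε : extPush T.E x ε = 0) : ∃ f : W ⟶ Z, extPull T.E f δ = ε := by
  obtain ⟨M, x', y', h'⟩ := T.exists_realizes ε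
  obtain ⟨b, hb⟩ := h'.exists_extend x hε
  obtain ⟨c, -, hc⟩ := T.et3 h' h (𝟙 A) b (by simp [hb])
  exact ⟨c, by rw [← hc, extPush_id]⟩

theorem Realizes.exists_retraction (h : T.Realizes x y (0 : ExtGroup T.E Z A)) :
    ∃ r : B ⟶ A, x ≫ r = 𝟙 A :=
  h.exists_extend (𝟙 A) (map_zero _)

theorem Realizes.exists_section (h : T.Realizes x y (0 : ExtGroup T.E Z A)) :
    ∃ s : Z ⟶ B, s ≫ y = 𝟙 Z :=
  h.exists_lift (𝟙 Z) (map_zero _)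

theorem realizes_zero_of_isBilimit {s : Z ⟶ B} {r : B ⟶ A} (hxr : x ≫ r = 𝟙 A)
    (hsy : s ≫ y = 𝟙 Z) (hxy : x ≫ y = 0) (hsr : s ≫ r = 0) (hid : r ≫ x + y ≫ s = 𝟙 B) :
    T.Realizes x y (0 : ExtGroup T.E Z A) :=
  (T.realizes_iff _ _ (T.realizes_zero A Z)).2
    ⟨⟨biprod.desc x s, biprod.lift r y, by ext <;> simp [hxr, hsy, hxy, hsr],
      by simp [hid]⟩, by simp, by ext <;> simp [hsy, hxy]⟩

variable [HasZeroObject C]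

open scoped ZeroObject

theorem Realizes.extPush_eq_zero (h : T.Realizes x y δ) : extPush T.E x δ = 0 := by
  obtain ⟨c, -, hc⟩ := T.et3 h (T.realizes_zero B 0) x biprod.inl rfl
  rw [hc, map_zero]

theorem Realizes.extPull_eq_zero (h : T.Realizes x y δ) : extPull T.E y δ = 0 := by
  obtain ⟨c, -, hc⟩ := T.et3_op (T.realizes_zero 0 B) h biprod.snd y rfl
  rw [← hc, map_zero]

theorem Realizes.comp_eq_zero (h : T.Realizes x y δ) : x ≫ y = 0 := by
  obtain ⟨c, hc, -⟩ := T.et3 (T.realizes_zero A 0) h (𝟙 A) (biprod.fst ≫ x) (by simp)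
  simpa using (biprod.inl ≫= hc).symm

theorem Realizes.exists_desc (h : T.Realizes x y δ) {W : C} (f : B ⟶ W) (hf : x ≫ f = 0) :
    ∃ g : Z ⟶ W, y ≫ g = f := by
  obtain ⟨c, hc, -⟩ := T.et3 h (T.realizes_zero 0 W) 0 (f ≫ biprod.inr) (by simp [reassoc_of% hf])
  exact ⟨c, by simpa using hc⟩

theorem Realizes.exists_factor (h : T.Realizes x y δ) {W : C} (f : W ⟶ B) (hf : f ≫ y = 0) :
    ∃ g : W ⟶ A, g ≫ x = f := by
  obtain ⟨a, ha, -⟩ := T.et3_op (T.realizes_zero W 0) h (biprod.fst ≫ f) 0 (by simp [hf])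
  exact ⟨a, by simpa using ha.symm⟩

/-- An endomorphism of the middle term inducing identities on the ends of a conflation is
invertible. -/
theorem Realizes.isIso_of_endo (h : T.Realizes x y δ) (f : B ⟶ B) (h₁ : x ≫ f = x)
    (h₂ : f ≫ y = y) : IsIso f := by
  obtain ⟨s, hs⟩ := h.exists_desc (f - 𝟙 B) (by simp [h₁])
  obtain ⟨t, ht⟩ := h.exists_factor (f - 𝟙 B) (by simp [h₂])
  have hu : (f - 𝟙 B) ≫ (f - 𝟙 B) = 0 := by
    nth_rw 1 [← ht]
    rw [← hs, Category.assoc, reassoc_of% h.comp_eq_zero, zero_comp, comp_zero]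
  simp only [Preadditive.sub_comp, Preadditive.comp_sub, Category.id_comp, Category.comp_id] at hu
  -- Since f - 𝟙 factors both through y and through x, it squares to zero, so 𝟙 - (f - 𝟙) inverts f.
  refine ⟨𝟙 B - (f - 𝟙 B), ?_, ?_⟩ <;>
  · simp only [Preadditive.sub_comp, Preadditive.comp_sub, Category.id_comp, Category.comp_id]
    have : f ≫ f = f + (f - 𝟙 B) := by
      rw [← sub_eq_zero, ← hu]; abel
    rw [this]; abel

/-- A five lemma for isomorphic ends: lift (i, j) and its inverse to the middle terms. Both
composites induce identities on the ends, so they are invertible, and hence so is the lift. -/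
theorem Realizes.of_iso (h : T.Realizes x y δ) {A' Z' : C} (i : A ≅ A') (j : Z ≅ Z') :
    T.Realizes (i.inv ≫ x) (y ≫ j.hom) (extPush T.E i.hom (extPull T.E j.inv δ)) := by
  obtain ⟨B', x', y', h'⟩ := T.exists_realizes (extPush T.E i.hom (extPull T.E j.inv δ))
  obtain ⟨b, hb₁, hb₂⟩ := T.lift h h' i.hom j.hom (by
    rw [← extPush_extPull, ← extPull_comp, j.hom_inv_id, extPull_id])
  obtain ⟨b', hb₁', hb₂'⟩ := T.lift h' h i.inv j.inv (by
    rw [← extPush_comp, i.hom_inv_id, extPush_id])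
  have : IsIso (b ≫ b') := h.isIso_of_endo _ (by rw [reassoc_of% hb₁, hb₁']; simp)
    (by rw [Category.assoc, ← hb₂', ← reassoc_of% hb₂]; simp)
  have : IsIso (b' ≫ b) := h'.isIso_of_endo _ (by rw [reassoc_of% hb₁', hb₁]; simp)
    (by rw [Category.assoc, ← hb₂, ← reassoc_of% hb₂']; simp)
  have : IsSplitMono b := .mk' ⟨b' ≫ inv (b ≫ b'), by simp [← Category.assoc]⟩
  have : IsSplitEpi b := .mk' ⟨inv (b' ≫ b) ≫ b', by simp⟩
  have : IsIso b := isIso_of_mono_of_isSplitEpi b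
  refine (T.realizes_iff _ _ h').2 ⟨(asIso b).symm, ?_, ?_⟩
  · simp [← cancel_mono b, hb₁]
  · simp [hb₂]

theorem Realizes.of_section (h : T.Realizes x y (0 : ExtGroup T.E Z A)) (s : Z ⟶ B)
    (hs : s ≫ y = 𝟙 Z) : ∃ r : B ⟶ A, T.Realizes s r (0 : ExtGroup T.E A Z) := by
  obtain ⟨r, hr⟩ := h.exists_factor (𝟙 B - y ≫ s) (by simp [hs])
  obtain ⟨r₀, hr₀⟩ := h.exists_retraction
  have key {W : C} (f g : W ⟶ A) (hfg : f ≫ x = g ≫ x) : f = g := by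
    simpa [hr₀] using hfg =≫ r₀
  refine ⟨r, realizes_zero_of_isBilimit hs (s := x) (key _ _ ?_) (key _ _ ?_) h.comp_eq_zero
    (by rw [hr]; abel)⟩
  · simp [hr, reassoc_of% h.comp_eq_zero]
  · simp [hr, reassoc_of% hs]

theorem Realizes.of_retraction (h : T.Realizes x y (0 : ExtGroup T.E Z A)) (r : B ⟶ A)
    (hr : x ≫ r = 𝟙 A) : ∃ s : Z ⟶ B, T.Realizes s r (0 : ExtGroup T.E A Z) := by
  obtain ⟨s, hs⟩ := h.exists_desc (𝟙 B - r ≫ x) (by simp [reassoc_of% hr])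
  obtain ⟨s₀, hs₀⟩ := h.exists_section
  have key {W : C} (f g : Z ⟶ W) (hfg : y ≫ f = y ≫ g) : f = g := by
    simpa [reassoc_of% hs₀] using s₀ ≫= hfg
  refine ⟨s, realizes_zero_of_isBilimit (s := x) (r := y) (key _ _ ?_) hr (key _ _ ?_)
    h.comp_eq_zero (by rw [hs]; abel)⟩
  · simp [reassoc_of% hs, h.comp_eq_zero]
  · simp [reassoc_of% hs, hr]

/-- Exactness of `𝔼(Z, Y) ⟶ 𝔼(B, Y) ⟶ 𝔼(A, Y)`. -/
theorem Realizes.exists_extPull_eq (h : T.Realizes x y δ) {Y : C} (ε : ExtGroup T.E B Y)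
    (hε : extPull T.E x ε = 0) : ∃ ε' : ExtGroup T.E Z Y, extPull T.E y ε' = ε := by
  obtain ⟨M, f', f, hf⟩ := T.exists_realizes ε
  -- The kernel N of the composite M → B → Z is an extension of A by Y with class the pullback of ε
  -- along x, which is zero. Pushing δ'' along a retraction N → Y gives the preimage of ε.
  obtain ⟨N, d, e, h', _, δ'', -, -, -, -, hde, -, hd⟩ := T.et4_op hf h
  rw [hε] at hde
  obtain ⟨r, hr⟩ := hde.exists_retraction
  exact ⟨extPush T.E r δ'', by rw [← extPush_extPull, ← hd, ← extPush_comp, hr, extPush_id]⟩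

/-- Exactness of `𝔼(W, A) ⟶ 𝔼(W, B) ⟶ 𝔼(W, Z)`. -/
theorem Realizes.exists_extPush_eq (h : T.Realizes x y δ) {W : C} (ε : ExtGroup T.E W B)
    (hε : extPush T.E y ε = 0) : ∃ ε' : ExtGroup T.E W A, extPush T.E x ε' = ε := by
  obtain ⟨M, g, g', hg⟩ := T.exists_realizes ε
  obtain ⟨N, d, e, _, h', δ'', -, -, -, -, hde, -, hd⟩ := T.et4 h hg
  rw [hε] at hde
  obtain ⟨s, hs⟩ := hde.exists_section
  exact ⟨extPull T.E s δ'', by rw [extPush_extPull, hd, ← extPull_comp, hs, extPull_id]⟩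

end Exactness

/-! ### Composition, pushout and pullback of conflations -/

section Conflations

variable {C : Type u} [Category.{v} C] [Preadditive C] [HasBinaryBiproducts C]
  {T : Extriangulation.{w} C}

theorem hasConflation_biprod (A Z : C) : T.HasConflation A (A ⊞ Z) Z :=
  ⟨_, _, _, T.realizes_zero A Z⟩

theorem HasConflation.biprod {A B Z A' B' Z' : C} (h : T.HasConflation A B Z)
    (h' : T.HasConflation A' B' Z') : T.HasConflation (A ⊞ A') (B ⊞ B') (Z ⊞ Z') := by
  obtain ⟨x, y, δ, h⟩ := h
  obtain ⟨x', y', δ', h'⟩ := h'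
  exact ⟨_, _, _, T.realizes_sum h h'⟩

theorem HasConflation.comp_inflation {A B D M F : C} (h : T.HasConflation A B D)
    (h' : T.HasConflation B M F) :
    ∃ N : C, T.HasConflation A M N ∧ T.HasConflation D N F := by
  obtain ⟨x, y, δ, h⟩ := h
  obtain ⟨x', y', δ', h'⟩ := h'
  obtain ⟨N, d, e, _, _, _, -, -, -, h₁, h₂, -, -⟩ := T.et4 h h'
  exact ⟨N, ⟨_, _, _, h₁⟩, ⟨_, _, _, h₂⟩⟩

theorem HasConflation.comp_deflation {D A B F M : C} (h : T.HasConflation D A B)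
    (h' : T.HasConflation F B M) :
    ∃ N : C, T.HasConflation N A M ∧ T.HasConflation D N F := by
  obtain ⟨x, y, δ, h⟩ := h
  obtain ⟨x', y', δ', h'⟩ := h'
  obtain ⟨N, d, e, _, _, _, -, -, -, h₁, h₂, -, -⟩ := T.et4_op h h'
  exact ⟨N, ⟨_, _, _, h₁⟩, ⟨_, _, _, h₂⟩⟩

theorem HasConflation.iso_of_subsingleton {A B Z : C} (h : T.HasConflation A B Z)
    (hs : Subsingleton (ExtGroup T.E Z A)) : Nonempty (A ⊞ Z ≅ B) := by
  obtain ⟨x, y, δ, h⟩ := h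
  rw [Subsingleton.elim δ 0] at h
  obtain ⟨b, -, -⟩ := (T.realizes_iff _ _ (T.realizes_zero A Z)).1 h
  exact ⟨b⟩

variable [HasZeroObject C]

theorem HasConflation.of_iso {A B Z A' B' Z' : C} (h : T.HasConflation A B Z) (i : A ≅ A')
    (b : B ≅ B') (j : Z ≅ Z') : T.HasConflation A' B' Z' := by
  obtain ⟨x, y, δ, h⟩ := h
  exact ⟨_, _, _, (T.realizes_iff ((i.inv ≫ x) ≫ b.hom) (b.inv ≫ y ≫ j.hom) (h.of_iso i j)).2
    ⟨b, rfl, by simp⟩⟩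

open scoped ZeroObject

theorem hasConflation_zero_left (A : C) : T.HasConflation 0 A A :=
  (hasConflation_biprod 0 A).of_iso (Iso.refl _) (isoZeroBiprod (isZero_zero C)).symm (Iso.refl _)

theorem hasConflation_zero_right (A : C) : T.HasConflation A A 0 :=
  (hasConflation_biprod A 0).of_iso (Iso.refl _) (isoBiprodZero (isZero_zero C)).symm (Iso.refl _)

theorem hasConflation_biprod' (A Z : C) : T.HasConflation Z (A ⊞ Z) A :=
  (hasConflation_biprod Z A).of_iso (Iso.refl _) (biprod.braiding Z A) (Iso.refl _)

/-- The pushout of a conflation along an inflation. -/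
theorem HasConflation.pushout {A B Z Y M : C} (h : T.HasConflation A B Z)
    (h' : T.HasConflation A Y M) :
    ∃ P : C, T.HasConflation Y P Z ∧ T.HasConflation B P M := by
  obtain ⟨x, y, δ, hx⟩ := h
  obtain ⟨x₂, y₂, δ₂, hx₂⟩ := h'
  obtain ⟨P, g, g', hg⟩ := T.exists_realizes (extPush T.E x δ₂)
  -- N is the cone of A → B → P, and Z → N → M splits because its class is δ₂ pushed along x ≫ y =
  -- 0.
  obtain ⟨N, d, e, k, k', δ'', -, -, -, hk, hde, hd, he⟩ := T.et4 hx hg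
  rw [← extPush_comp, hx.comp_eq_zero] at hde
  have h0 : extPush T.E (0 : A ⟶ Z) δ₂ = 0 := by
    simpa using T.extPush_sub (0 : A ⟶ Z) 0 δ₂
  rw [h0] at hde
  obtain ⟨s, hs⟩ := hde.exists_section
  -- An arbitrary section s need not pull δ'' back to δ₂, but the error dies under x, so it is
  -- pulled back from δ along some t. Correcting s by t gives a section that recovers δ₂.
  obtain ⟨t, ht⟩ := hx.exists_eq_extPull (extPull T.E s δ'' - δ₂) (by
    rw [map_sub, extPush_extPull, he, ← extPull_comp, hs, extPull_id, sub_self])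
  have hs' : (s - t ≫ d) ≫ e = 𝟙 M := by simp [hs, hde.comp_eq_zero]
  have hδ : extPull T.E (s - t ≫ d) δ'' = δ₂ := by
    rw [extPull_sub, extPull_comp, hd, ht]; abel
  obtain ⟨r, hr⟩ := hde.of_section _ hs'
  -- The kernel of P → N → Z is an extension of M by A with class δ₂, hence isomorphic to Y.
  obtain ⟨N₂, d₂, e₂, _, _, _, -, -, -, h₁, h₂, -, -⟩ := T.et4_op hk hr
  rw [hδ] at h₂
  obtain ⟨b, -, -⟩ := (T.realizes_iff _ _ h₂).1 hx₂
  exact ⟨P, HasConflation.of_iso ⟨_, _, _, h₁⟩ b (Iso.refl _) (Iso.refl _), ⟨_, _, _, hg⟩⟩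

/-- The pullback of a conflation along a deflation. -/
theorem HasConflation.pullback {A B Z Y M : C} (h : T.HasConflation A B Z)
    (h' : T.HasConflation Y M Z) :
    ∃ P : C, T.HasConflation A P M ∧ T.HasConflation Y P B := by
  obtain ⟨x, y, δ, hx⟩ := h
  obtain ⟨x₂, y₂, δ₂, hx₂⟩ := h'
  obtain ⟨P, f', f, hf⟩ := T.exists_realizes (extPull T.E y δ₂)
  obtain ⟨N, d, e, k', k, δ'', -, -, -, hk, hde, he, hd⟩ := T.et4_op hf hx
  rw [← extPull_comp, hx.comp_eq_zero] at hde
  have h0 : extPull T.E (0 : A ⟶ Z) δ₂ = 0 := by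
    simpa using T.extPull_sub (0 : A ⟶ Z) 0 δ₂
  rw [h0] at hde
  obtain ⟨r, hr⟩ := hde.exists_retraction
  obtain ⟨t, ht⟩ := hx.exists_eq_extPush (extPush T.E r δ'' - δ₂) (by
    rw [map_sub, ← extPush_extPull, ← hd, ← extPush_comp, hr, extPush_id, sub_self])
  have hr' : d ≫ (r - e ≫ t) = 𝟙 Y := by simp [hr, reassoc_of% hde.comp_eq_zero]
  have hδ : extPush T.E (r - e ≫ t) δ'' = δ₂ := by
    rw [extPush_sub, extPush_comp, he, ht]; abel
  obtain ⟨s, hs⟩ := hde.of_retraction _ hr'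
  obtain ⟨N₂, d₂, e₂, _, _, _, -, -, -, h₁, h₂, -, -⟩ := T.et4 hs hk
  rw [hδ] at h₂
  obtain ⟨b, -, -⟩ := (T.realizes_iff _ _ h₂).1 hx₂
  exact ⟨P, HasConflation.of_iso ⟨_, _, _, h₁⟩ (Iso.refl _) (Iso.refl _) b, ⟨_, _, _, hf⟩⟩

end Conflations

end Extriangulation

/-! ### Vanishing of higher extensions in the three settings -/

namespace Extriangulation

/-- The formal properties of the relations `𝔼^{k+1}(X, Y) = 0` that follow from the long exact
sequences of higher extension groups. -/
structure VanishingTheory {C : Type u} [Category.{v} C] [Preadditive C] [HasBinaryBiproducts C]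
    (T : Extriangulation.{w} C) (V : ℕ → C → C → Prop) : Prop where
  retract_left : ∀ {k : ℕ} {X X' Y : C} (i : X ⟶ X') (r : X' ⟶ X), i ≫ r = 𝟙 X →
    V k X' Y → V k X Y
  retract_right : ∀ {k : ℕ} {X Y Y' : C} (i : Y ⟶ Y') (r : Y' ⟶ Y), i ≫ r = 𝟙 Y →
    V k X Y' → V k X Y
  ext_left : ∀ {k : ℕ} {A B Z Y : C}, T.HasConflation A B Z → V k A Y → V k Z Y → V k B Y
  cocone_left : ∀ {k : ℕ} {A B Z Y : C}, T.HasConflation A B Z →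
    V k B Y → V (k + 1) Z Y → V k A Y
  cone_left : ∀ {k : ℕ} {A B Z Y : C}, T.HasConflation A B Z →
    V k A Y → V (k + 1) B Y → V (k + 1) Z Y
  ext_right : ∀ {k : ℕ} {X A B Z : C}, T.HasConflation A B Z → V k X A → V k X Z → V k X B
  cone_right : ∀ {k : ℕ} {X A B Z : C}, T.HasConflation A B Z →
    V k X B → V (k + 1) X A → V k X Z
  split : ∀ {A B Z : C}, T.HasConflation A B Z → V 0 Z A → Nonempty (A ⊞ Z ≅ B)

theorem subsingleton_of_forall_eq_zero {G : Type*} [AddGroup G] (h : ∀ g : G, g = 0) :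
    Subsingleton G :=
  ⟨fun f g => (h f).trans (h g).symm⟩

theorem subsingleton_hom_of_iso {C : Type u} [Category.{v} C] {X X' Y Y' : C} (e : X ≅ X') (e' : Y ≅ Y')
    (h : Subsingleton (X ⟶ Y)) : Subsingleton (X' ⟶ Y') :=
  (e.homCongr e').symm.subsingleton

section Triangulated

open Pretriangulated

variable {C : Type u} [Category.{v} C] [Preadditive C] [HasZeroObject C] [HasShift C ℤ]
  [∀ n : ℤ, (shiftFunctor C n).Additive] [Pretriangulated C]

theorem vanishingTheory_of_triangulated [HasBinaryBiproducts C] (T : Extriangulation.{w} C)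
    (φ : ∀ Z A : C, ExtGroup T.E Z A ≃+ (Z ⟶ A⟦(1 : ℤ)⟧))
    (h : ∀ {A B Z : C} (x : A ⟶ B) (y : B ⟶ Z) (δ : ExtGroup T.E Z A),
      T.Realizes x y δ ↔ Triangle.mk x y (φ Z A δ) ∈ distinguishedTriangles) :
    T.VanishingTheory fun k X Y => Subsingleton (X ⟶ Y⟦((k + 1 : ℕ) : ℤ)⟧) where
  retract_left i r hir hs := ⟨fun f g => by
    rw [← Category.id_comp f, ← Category.id_comp g, ← hir, Category.assoc, Category.assoc,
      Subsingleton.elim (r ≫ f) (r ≫ g)]⟩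
  retract_right {k} _ _ _ i r hir hs := ⟨fun f g => by
    have key {W : C} (f : W ⟶ _) : f = (f ≫ i⟦((k + 1 : ℕ) : ℤ)⟧') ≫ r⟦((k + 1 : ℕ) : ℤ)⟧' := by
      rw [Category.assoc, ← Functor.map_comp, hir, CategoryTheory.Functor.map_id, Category.comp_id]
    rw [key f, key g, Subsingleton.elim (f ≫ i⟦_⟧') (g ≫ i⟦_⟧')]⟩
  ext_left := by
    rintro k A B Z Y ⟨x, y, δ, hT⟩ h₁ h₂
    rw [h] at hT
    refine subsingleton_of_forall_eq_zero fun f => ?_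
    obtain ⟨g, rfl⟩ := Triangle.yoneda_exact₂ _ hT f (Subsingleton.elim (α := A ⟶ _) _ _)
    rw [Subsingleton.elim (α := Z ⟶ _) g 0]
    exact comp_zero
  cocone_left := by
    rintro k A B Z Y ⟨x, y, δ, hT⟩ h₁ h₂
    rw [h] at hT
    refine subsingleton_of_forall_eq_zero fun f => ?_
    have h₃ : Subsingleton (Z ⟶ Y⟦((k + 1 : ℕ) : ℤ)⟧⟦(1 : ℤ)⟧) :=
      subsingleton_hom_of_iso (Iso.refl _) ((shiftFunctorAdd' C _ 1 _ (by push_cast; rfl)).app Y) h₂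
    -- The obstruction to extending f over B is a map Z → Y[k+2]. Shifting f once makes this
    -- composite visible in the rotated triangle; full faithfulness of the shift then returns to f.
    obtain ⟨g, hg⟩ := Triangle.yoneda_exact₃ _ (rot_of_distTriang _ hT) (f⟦(1 : ℤ)⟧')
      (Subsingleton.elim (α := Z ⟶ _) _ _)
    obtain ⟨g, rfl⟩ := (shiftFunctor C (1 : ℤ)).map_surjective (X := B) g
    apply (shiftFunctor C (1 : ℤ)).map_injective
    refine hg.trans ?_
    rw [Subsingleton.elim g 0, Functor.map_zero, Functor.map_zero]
    exact comp_zero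
  cone_left := by
    rintro k A B Z Y ⟨x, y, δ, hT⟩ h₁ h₂
    rw [h] at hT
    let e : Y⟦((k + 1 + 1 : ℕ) : ℤ)⟧ ≅ Y⟦((k + 1 : ℕ) : ℤ)⟧⟦(1 : ℤ)⟧ :=
      (shiftFunctorAdd' C _ 1 _ (by push_cast; rfl)).app Y
    have h₃ := subsingleton_hom_of_iso (Iso.refl _) e h₂
    refine subsingleton_hom_of_iso (Iso.refl _) e.symm ?_
    refine subsingleton_of_forall_eq_zero fun f => ?_
    obtain ⟨g, rfl⟩ := Triangle.yoneda_exact₃ _ hT f (Subsingleton.elim (α := B ⟶ _) _ _)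
    obtain ⟨g, rfl⟩ := (shiftFunctor C (1 : ℤ)).map_surjective (X := A) g
    rw [Subsingleton.elim g 0, Functor.map_zero]
    exact comp_zero
  ext_right := by
    rintro k X A B Z ⟨x, y, δ, hT⟩ h₁ h₂
    rw [h] at hT
    refine subsingleton_of_forall_eq_zero fun f => ?_
    obtain ⟨g, rfl⟩ := Triangle.coyoneda_exact₂ _
      (Triangle.shift_distinguished _ hT ((k + 1 : ℕ) : ℤ)) f
      (Subsingleton.elim (α := X ⟶ Z⟦((k + 1 : ℕ) : ℤ)⟧) _ _)
    rw [Subsingleton.elim (α := X ⟶ A⟦((k + 1 : ℕ) : ℤ)⟧) g 0]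
    exact zero_comp
  cone_right := by
    rintro k X A B Z ⟨x, y, δ, hT⟩ h₁ h₂
    rw [h] at hT
    refine subsingleton_of_forall_eq_zero fun f => ?_
    have h₃ : Subsingleton (X ⟶ A⟦((k + 1 : ℕ) : ℤ)⟧⟦(1 : ℤ)⟧) :=
      subsingleton_hom_of_iso (Iso.refl _) ((shiftFunctorAdd' C _ 1 _ (by push_cast; rfl)).app A) h₂
    obtain ⟨g, rfl⟩ := Triangle.coyoneda_exact₃ _
      (Triangle.shift_distinguished _ hT ((k + 1 : ℕ) : ℤ)) f
      (Subsingleton.elim (α := X ⟶ A⟦((k + 1 : ℕ) : ℤ)⟧⟦(1 : ℤ)⟧) _ _)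
    rw [Subsingleton.elim (α := X ⟶ B⟦((k + 1 : ℕ) : ℤ)⟧) g 0]
    exact zero_comp
  split := by
    intro A B Z hT hs
    exact hT.iso_of_subsingleton ⟨fun a b => (φ Z A).injective
      (Subsingleton.elim (α := Z ⟶ A⟦((0 + 1 : ℕ) : ℤ)⟧) _ _)⟩

end Triangulated

section Abelian

open Abelian

variable {C : Type u} [Category.{v} C] [Abelian C] [HasExt.{w} C]

theorem vanishingTheory_of_abelian [HasBinaryBiproducts C] (T : Extriangulation C)
    (h : ∀ {A B Z : C} (x : A ⟶ B) (y : B ⟶ Z), T.Conflation x y ↔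
      ∃ zero : x ≫ y = 0, (ShortComplex.mk x y zero).ShortExact) :
    T.VanishingTheory fun k X Y => Subsingleton (Ext.{w} X Y (k + 1)) where
  retract_left {k X X' Y} i r hir hs := ⟨fun f g => by
    have key (f : Ext.{w} X Y (k + 1)) : f = (Ext.mk₀ i).comp ((Ext.mk₀ r).comp f (zero_add _))
        (zero_add _) := by
      rw [Ext.mk₀_comp_mk₀_assoc, hir, Ext.mk₀_id_comp]
    rw [key f, key g, Subsingleton.elim ((Ext.mk₀ r).comp f _) ((Ext.mk₀ r).comp g _)]⟩
  retract_right {k X Y Y'} i r hir hs := ⟨fun f g => by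
    have key (f : Ext.{w} X Y (k + 1)) : f = (f.comp (Ext.mk₀ i) (add_zero _)).comp (Ext.mk₀ r)
        (add_zero _) := by
      rw [Ext.comp_assoc_of_second_deg_zero, Ext.mk₀_comp_mk₀, hir, Ext.comp_mk₀_id]
    rw [key f, key g, Subsingleton.elim (f.comp (Ext.mk₀ i) _) (g.comp (Ext.mk₀ i) _)]⟩
  ext_left := by
    rintro k A B Z Y ⟨x, y, hT⟩ h₁ h₂
    obtain ⟨_, hS⟩ := (h x y).1 hT
    refine subsingleton_of_forall_eq_zero fun f => ?_
    obtain ⟨g, rfl⟩ := Ext.contravariant_sequence_exact₂ hS Y f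
      (Subsingleton.elim (α := Ext A Y _) _ _)
    rw [Subsingleton.elim (α := Ext Z Y _) g 0, Ext.comp_zero]
  cocone_left := by
    rintro k A B Z Y ⟨x, y, hT⟩ h₁ h₂
    obtain ⟨_, hS⟩ := (h x y).1 hT
    refine subsingleton_of_forall_eq_zero fun f => ?_
    obtain ⟨g, rfl⟩ := Ext.contravariant_sequence_exact₁ hS Y f (add_comm 1 (k + 1))
      (Subsingleton.elim (α := Ext Z Y _) _ _)
    rw [Subsingleton.elim (α := Ext B Y _) g 0, Ext.comp_zero]
  cone_left := by
    rintro k A B Z Y ⟨x, y, hT⟩ h₁ h₂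
    obtain ⟨_, hS⟩ := (h x y).1 hT
    refine subsingleton_of_forall_eq_zero fun f => ?_
    obtain ⟨g, rfl⟩ := Ext.contravariant_sequence_exact₃ hS Y f
      (Subsingleton.elim (α := Ext B Y _) _ _) (n₀ := k + 1) (add_comm 1 (k + 1))
    rw [Subsingleton.elim (α := Ext A Y _) g 0, Ext.comp_zero]
  ext_right := by
    rintro k X A B Z ⟨x, y, hT⟩ h₁ h₂
    obtain ⟨_, hS⟩ := (h x y).1 hT
    refine subsingleton_of_forall_eq_zero fun f => ?_
    obtain ⟨g, rfl⟩ := Ext.covariant_sequence_exact₂ X hS f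
      (Subsingleton.elim (α := Ext X Z _) _ _)
    rw [Subsingleton.elim (α := Ext X A _) g 0, Ext.zero_comp]
  cone_right := by
    rintro k X A B Z ⟨x, y, hT⟩ h₁ h₂
    obtain ⟨_, hS⟩ := (h x y).1 hT
    refine subsingleton_of_forall_eq_zero fun f => ?_
    obtain ⟨g, rfl⟩ := Ext.covariant_sequence_exact₃ X hS f rfl
      (Subsingleton.elim (α := Ext X A _) _ _)
    rw [Subsingleton.elim (α := Ext X B _) g 0, Ext.zero_comp]
  split := by
    rintro A B Z ⟨x, y, hT⟩ hs
    obtain ⟨_, hS⟩ := (h x y).1 hT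
    -- The identity of Z, as a class in degree 0, lifts to B because its connecting image lies in
    -- Ext¹(Z, A) = 0; the lift is a section.
    obtain ⟨g, hg⟩ := Ext.covariant_sequence_exact₃ Z hS (Ext.mk₀ (𝟙 Z)) rfl
      (Subsingleton.elim (α := Ext Z A (0 + 1)) _ _)
    obtain ⟨s, rfl⟩ := (Ext.mk₀_bijective _ _).2 g
    rw [Ext.mk₀_comp_mk₀] at hg
    have := hS.mono_f
    exact ⟨(ShortComplex.Splitting.ofExactOfSection _ hS.exact s
      ((Ext.mk₀_bijective _ _).1 hg) hS.mono_f).isoBinaryBiproduct.symm⟩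

end Abelian

/-! ### Dimension shifting with enough projectives and injectives -/

section EnoughProjectivesAndInjectives

variable {C : Type u} [Category.{v} C] [Preadditive C] [HasBinaryBiproducts C]
  {T : Extriangulation.{w} C}

variable (T) in
/-- The class `Ω^k X` of `k`-th syzygies of an object `X`. -/
def syzygy : ℕ → C → ObjectProperty C
  | 0, X => fun Z => Z = X
  | k + 1, X => fun Z => ∃ X' P : C, T.projectives P ∧ T.HasConflation X' P X ∧ syzygy k X' Z

theorem exists_syzygy (hT : T.EnoughProj) (k : ℕ) (X : C) : ∃ Z, T.syzygy k X Z := by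
  induction k generalizing X with
  | zero => exact ⟨X, rfl⟩
  | succ k ih =>
    obtain ⟨X', P, hP, h⟩ := hT X
    obtain ⟨Z, hZ⟩ := ih X'
    exact ⟨Z, X', P, hP, h, hZ⟩

theorem exists_cosyzygy (hT : T.EnoughInj) (k : ℕ) (Y : C) : ∃ Z, T.cosyzygy Y k Z := by
  induction k with
  | zero => exact ⟨Y, rfl⟩
  | succ k ih =>
    obtain ⟨Z, hZ⟩ := ih
    obtain ⟨I, Z', hI, h⟩ := hT Z
    exact ⟨Z', Z, I, hZ, hI, h⟩

/-- The recursion defining `syzygy` unrolls at the X end; long exact sequences in the second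
variable need one more step at the other end. -/
theorem syzygy.snoc {k : ℕ} {X Z P Z' : C} (hZ : T.syzygy k X Z) (hP : T.projectives P)
    (h : T.HasConflation Z' P Z) : T.syzygy (k + 1) X Z' := by
  induction k generalizing X with
  | zero =>
    obtain rfl : Z = X := hZ
    exact ⟨Z', P, hP, h, rfl⟩
  | succ k ih =>
    obtain ⟨X', Q, hQ, hX', hZ⟩ := hZ
    exact ⟨X', Q, hQ, hX', ih hZ⟩

variable [HasZeroObject C]

theorem eq_zero_of_projectives {P Y : C} (hP : T.projectives P) (ε : ExtGroup T.E P Y) :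
    ε = 0 := by
  obtain ⟨M, x, y, h⟩ := T.exists_realizes ε
  obtain ⟨s, hs⟩ := hP x y ⟨_, h⟩ (𝟙 P)
  rw [← extPull_id T.E ε, ← hs, extPull_comp, h.extPull_eq_zero, map_zero]

theorem eq_zero_of_injectives {I X : C} (hI : T.injectives I) (ε : ExtGroup T.E X I) :
    ε = 0 := by
  obtain ⟨M, x, y, h⟩ := T.exists_realizes ε
  obtain ⟨r, hr⟩ := hI x y ⟨_, h⟩ (𝟙 I)
  rw [← extPush_id T.E ε, ← hr, extPush_comp, h.extPush_eq_zero, map_zero]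

/-- Every class in either group comes from a morphism X' → Y', via ε or via δ. It vanishes in 𝔼(X,
Y') when the morphism lifts to I, and in 𝔼(X', Y) when it extends to P. Vanishing of one group
provides the factorization that kills the other. -/
theorem subsingleton_iff_of_projectives_of_injectives {X P X' Y I Y' : C} (hP : T.projectives P)
    (hI : T.injectives I) (hX : T.HasConflation X' P X) (hY : T.HasConflation Y I Y') :
    Subsingleton (ExtGroup T.E X Y') ↔ Subsingleton (ExtGroup T.E X' Y) := by
  obtain ⟨x, y, δ, hX⟩ := hX
  obtain ⟨i, p, ε, hY⟩ := hY
  constructor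
  · refine fun hs => subsingleton_of_forall_eq_zero fun θ => ?_
    obtain ⟨f, rfl⟩ := hY.exists_eq_extPull θ (eq_zero_of_injectives hI _)
    obtain ⟨g, rfl⟩ := hX.exists_extend f (Subsingleton.elim _ _)
    rw [extPull_comp, eq_zero_of_projectives hP (extPull T.E g ε), map_zero]
  · refine fun hs => subsingleton_of_forall_eq_zero fun θ => ?_
    obtain ⟨f, rfl⟩ := hX.exists_eq_extPush θ (eq_zero_of_projectives hP _)
    obtain ⟨g, rfl⟩ := hY.exists_lift f (Subsingleton.elim _ _)
    rw [extPush_comp, eq_zero_of_injectives hI (extPush T.E g δ), map_zero]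

theorem subsingleton_iff_of_syzygy_of_cosyzygy {k : ℕ} {X X' Y Y' : C} (hX : T.syzygy k X X')
    (hY : T.cosyzygy Y k Y') :
    Subsingleton (ExtGroup T.E X Y') ↔ Subsingleton (ExtGroup T.E X' Y) := by
  induction k generalizing X Y' with
  | zero =>
    obtain rfl : X' = X := hX
    obtain rfl : Y' = Y := hY
    rfl
  | succ k ih =>
    obtain ⟨X₁, P, hP, hX₁, hX'⟩ := hX
    obtain ⟨Y₁, I, hY₁, hI, hY'⟩ := hY
    rw [subsingleton_iff_of_projectives_of_injectives hP hI hX₁ hY', ih hX' hY₁]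

theorem vanishingTheory_of_enough (hP : T.EnoughProj) (hI : T.EnoughInj) :
    T.VanishingTheory fun k X Y =>
      ∀ Z : C, T.cosyzygy Y k Z → Subsingleton (ExtGroup T.E X Z) := by
  -- Moving the shift from Y to X allows statements in the second variable to be tested on a single
  -- group 𝔼(X', -), while those in the first variable use 𝔼(-, Z) for a fixed cosyzygy Z.
  have key {k : ℕ} {X X' : C} (hX : T.syzygy k X X') (Y : C) :
      (∀ Z : C, T.cosyzygy Y k Z → Subsingleton (ExtGroup T.E X Z)) ↔
        Subsingleton (ExtGroup T.E X' Y) := by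
    refine ⟨fun h => ?_, fun h Z hZ => (subsingleton_iff_of_syzygy_of_cosyzygy hX hZ).2 h⟩
    obtain ⟨Z, hZ⟩ := exists_cosyzygy hI k Y
    exact (subsingleton_iff_of_syzygy_of_cosyzygy hX hZ).1 (h Z hZ)
  refine ⟨?_, ?_, ?_, ?_, ?_, ?_, ?_, ?_⟩
  · intro k X X' Y i r hir h Z hZ
    have := h Z hZ
    refine subsingleton_of_forall_eq_zero fun ε => ?_
    rw [← extPull_id T.E ε, ← hir, extPull_comp, Subsingleton.elim (extPull T.E r ε) 0, map_zero]
  · intro k X Y Y' i r hir h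
    obtain ⟨X', hX'⟩ := exists_syzygy hP k X
    rw [key hX'] at h ⊢
    refine subsingleton_of_forall_eq_zero fun ε => ?_
    rw [← extPush_id T.E ε, ← hir, extPush_comp, Subsingleton.elim (extPush T.E i ε) 0, map_zero]
  · rintro k A B Z Y ⟨x, y, δ, hT⟩ h₁ h₂ W hW
    have := h₁ W hW
    have := h₂ W hW
    refine subsingleton_of_forall_eq_zero fun ε => ?_
    obtain ⟨ε', rfl⟩ := hT.exists_extPull_eq ε (Subsingleton.elim _ _)
    rw [Subsingleton.elim ε' 0, map_zero]
  · rintro k A B Z Y ⟨x, y, δ, hT⟩ h₁ h₂ W hW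
    obtain ⟨I, W', hI', i, p, θ, hi⟩ := hI W
    have := h₁ W hW
    have := h₂ W' ⟨W, I, hW, hI', i, p, θ, hi⟩
    refine subsingleton_of_forall_eq_zero fun ε => ?_
    obtain ⟨f, rfl⟩ := hi.exists_eq_extPull ε (eq_zero_of_injectives hI' _)
    obtain ⟨g, rfl⟩ := hT.exists_extend f (Subsingleton.elim _ _)
    rw [extPull_comp, Subsingleton.elim (extPull T.E g θ) 0, map_zero]
  · rintro k A B Z Y ⟨x, y, δ, hT⟩ h₁ h₂ W' hW'
    have := h₂ W' hW'
    obtain ⟨W, I, hW, hI', i, p, θ, hi⟩ := hW'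
    have := h₁ W hW
    refine subsingleton_of_forall_eq_zero fun ε => ?_
    obtain ⟨f, rfl⟩ := hT.exists_eq_extPush ε (Subsingleton.elim _ _)
    obtain ⟨g, rfl⟩ := hi.exists_lift f (Subsingleton.elim _ _)
    rw [extPush_comp, eq_zero_of_injectives hI' (extPush T.E g δ), map_zero]
  · rintro k X A B Z ⟨x, y, δ, hT⟩ h₁ h₂
    obtain ⟨X', hX'⟩ := exists_syzygy hP k X
    rw [key hX'] at h₁ h₂ ⊢
    refine subsingleton_of_forall_eq_zero fun ε => ?_
    obtain ⟨ε', rfl⟩ := hT.exists_extPush_eq ε (Subsingleton.elim _ _)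
    rw [Subsingleton.elim ε' 0, map_zero]
  · rintro k X A B Z ⟨x, y, δ, hT⟩ h₁ h₂
    obtain ⟨X', hX'⟩ := exists_syzygy hP k X
    obtain ⟨X'', P, hP', i, p, θ, hi⟩ := hP X'
    rw [key hX'] at h₁ ⊢
    rw [key (hX'.snoc hP' ⟨i, p, θ, hi⟩)] at h₂
    refine subsingleton_of_forall_eq_zero fun ε => ?_
    obtain ⟨f, rfl⟩ := hi.exists_eq_extPush ε (eq_zero_of_projectives hP' _)
    obtain ⟨g, rfl⟩ := hT.exists_lift f (Subsingleton.elim _ _)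
    rw [extPush_comp, Subsingleton.elim (extPush T.E g θ) 0, map_zero]
  · intro A B Z hT h
    exact hT.iso_of_subsingleton (h A rfl)

end EnoughProjectivesAndInjectives

theorem HigherExtensions.vanishingTheory {C : Type u} [Category.{v} C] [Preadditive C]
    [HasZeroObject C] [HasBinaryBiproducts C] {T : Extriangulation.{w} C}
    (H : T.HigherExtensions) : T.VanishingTheory fun k => H.ExtVanishes (k + 1) := by
  cases H with
  | abelian normalMono normalEpi kernels cokernels h =>
    let : Abelian C :=
      { (inferInstance : Preadditive C) with
        toIsNormalMonoCategory := normalMono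
        toIsNormalEpiCategory := normalEpi
        has_finite_products := hasFiniteProducts_of_has_binary_and_terminal
        has_kernels := kernels
        has_cokernels := cokernels }
    let : HasExt.{max u v} C := HasExt.standard C
    exact vanishingTheory_of_abelian T h
  | triangulated shift additive pretriangulated octahedron φ φ_push φ_pull h =>
    exact vanishingTheory_of_triangulated T φ h
  | enough hP hI => exact vanishingTheory_of_enough hP hI

end Extriangulation

namespace Extriangulation

/-! ### Perpendicular classes and closure properties -/

section Perpendicular

variable {C : Type u} [Category.{v} C] [Preadditive C] [HasBinaryBiproducts C]
  {T : Extriangulation.{w} C} {V : ℕ → C → C → Prop}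

/-- The objects `Z` with `V k Z Y` for all `k` and all `Y ∈ G`. -/
def leftPerp (V : ℕ → C → C → Prop) (G : ObjectProperty C) : ObjectProperty C :=
  fun Z => ∀ ⦃Y : C⦄, G Y → ∀ k : ℕ, V k Z Y

/-- The objects `Z` with `V k X Z` for all `k` and all `X ∈ F`. -/
def rightPerp (V : ℕ → C → C → Prop) (F : ObjectProperty C) : ObjectProperty C :=
  fun Z => ∀ ⦃X : C⦄, F X → ∀ k : ℕ, V k X Z

/-- The objects `Z` such that, for some `n`, `V k Z Y` for all `k ≥ n` and all `Y ∈ G`. -/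
def boundedPerp (V : ℕ → C → C → Prop) (G : ObjectProperty C) : ObjectProperty C :=
  fun Z => ∃ n : ℕ, ∀ ⦃Y : C⦄, G Y → ∀ k : ℕ, n ≤ k → V k Z Y

theorem VanishingTheory.summand_left (hV : T.VanishingTheory V) {k : ℕ} {A B Z Y : C}
    (e : A ⊞ B ≅ Z) (h : V k Z Y) : V k A Y :=
  hV.retract_left (biprod.inl ≫ e.hom) (e.inv ≫ biprod.fst) (by simp) h

theorem VanishingTheory.summand_right (hV : T.VanishingTheory V) {k : ℕ} {A B Z X : C}
    (e : A ⊞ B ≅ Z) (h : V k X Z) : V k X A :=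
  hV.retract_right (biprod.inl ≫ e.hom) (e.inv ≫ biprod.fst) (by simp) h

theorem VanishingTheory.isLeftThick_leftPerp (hV : T.VanishingTheory V) (G : ObjectProperty C) :
    T.IsLeftThick (leftPerp V G) where
  extensions _ _ _ h hA hZ _ hY k := hV.ext_left h (hA hY k) (hZ hY k)
  summands := fun _ _ _ ⟨e⟩ hZ _ hY k => hV.summand_left e (hZ hY k)
  cocones := fun _ ⟨_, _, hB, hZ, h⟩ _ hY k => hV.cocone_left h (hB hY k) (hZ hY (k + 1))

theorem VanishingTheory.isRightThick_rightPerp (hV : T.VanishingTheory V)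
    (F : ObjectProperty C) : T.IsRightThick (rightPerp V F) where
  extensions _ _ _ h hA hZ _ hX k := hV.ext_right h (hA hX k) (hZ hX k)
  summands := fun _ _ _ ⟨e⟩ hZ _ hX k => hV.summand_right e (hZ hX k)
  cones := fun _ ⟨_, _, hA, hB, h⟩ _ hX k => hV.cone_right h (hB hX k) (hA hX (k + 1))

theorem VanishingTheory.isThick_boundedPerp (hV : T.VanishingTheory V) (G : ObjectProperty C) :
    T.IsThick (boundedPerp V G) := by
  have hext : T.ClosedUnderExtensions (boundedPerp V G) := by
    rintro A B Z h ⟨m, hm⟩ ⟨n, hn⟩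
    exact ⟨max m n, fun Y hY k hk => hV.ext_left h (hm hY k (by omega)) (hn hY k (by omega))⟩
  have hsum : ClosedUnderSummands (boundedPerp V G) := by
    rintro A B Z ⟨e⟩ ⟨n, hn⟩
    exact ⟨n, fun Y hY k hk => hV.summand_left e (hn hY k hk)⟩
  refine ⟨⟨hext, hsum, ?_⟩, ⟨hext, hsum, ?_⟩⟩
  · rintro A ⟨B, Z, ⟨m, hm⟩, ⟨n, hn⟩, h⟩
    exact ⟨max m n, fun Y hY k hk =>
      hV.cocone_left h (hm hY k (by omega)) (hn hY (k + 1) (by omega))⟩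
  · rintro Z ⟨A, B, ⟨m, hm⟩, ⟨n, hn⟩, h⟩
    -- Passing to a cone raises the degree contributed by A by one, hence the extra 1, which also
    -- ensures that k is a successor.
    refine ⟨max m n + 1, fun Y hY k hk => ?_⟩
    obtain ⟨k, rfl⟩ := Nat.exists_eq_add_of_le' (show 1 ≤ k by omega)
    exact hV.cone_left h (hm hY k (by omega)) (hn hY (k + 1) (by omega))

end Perpendicular

section Closure

variable {C : Type u} [Category.{v} C] [Preadditive C] [HasBinaryBiproducts C]
  {T : Extriangulation.{w} C} {X Y : ObjectProperty C}

theorem ClosedUnderSummands.inf (hX : ClosedUnderSummands X) (hY : ClosedUnderSummands Y) :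
    ClosedUnderSummands (X ⊓ Y) :=
  fun _ _ _ e h => ⟨hX e h.1, hY e h.2⟩

theorem ClosedUnderExtensions.inf (hX : T.ClosedUnderExtensions X)
    (hY : T.ClosedUnderExtensions Y) : T.ClosedUnderExtensions (X ⊓ Y) :=
  fun _ _ _ h hA hZ => ⟨hX h hA.1 hZ.1, hY h hA.2 hZ.2⟩

theorem IsLeftThick.inf (hX : T.IsLeftThick X) (hY : T.IsLeftThick Y) : T.IsLeftThick (X ⊓ Y) :=
  ⟨ClosedUnderExtensions.inf hX.1 hY.1, hX.2.inf hY.2, fun _ ⟨_, _, hB, hZ, h⟩ =>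
    ⟨hX.3 _ ⟨_, _, hB.1, hZ.1, h⟩, hY.3 _ ⟨_, _, hB.2, hZ.2, h⟩⟩⟩

theorem IsRightThick.inf (hX : T.IsRightThick X) (hY : T.IsRightThick Y) :
    T.IsRightThick (X ⊓ Y) :=
  ⟨ClosedUnderExtensions.inf hX.1 hY.1, hX.2.inf hY.2, fun _ ⟨_, _, hA, hB, h⟩ =>
    ⟨hX.3 _ ⟨_, _, hA.1, hB.1, h⟩, hY.3 _ ⟨_, _, hA.2, hB.2, h⟩⟩⟩

theorem isThick_thick (X : ObjectProperty C) : T.IsThick (T.thick X) := by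
  have hext : T.ClosedUnderExtensions (T.thick X) :=
    fun _ _ _ h hA hZ P hP hX => hP.1.extensions h (hA P hP hX) (hZ P hP hX)
  have hsum : ClosedUnderSummands (T.thick X) :=
    fun _ _ _ e h P hP hX => hP.1.summands e (h P hP hX)
  exact ⟨⟨hext, hsum, fun _ ⟨_, _, hB, hZ, h⟩ P hP hX =>
    hP.1.cocones _ ⟨_, _, hB P hP hX, hZ P hP hX, h⟩⟩, ⟨hext, hsum, fun _ ⟨_, _, hA, hB, h⟩ P hP hX =>
    hP.2.cones _ ⟨_, _, hA P hP hX, hB P hP hX, h⟩⟩⟩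

theorem le_thick (X : ObjectProperty C) : X ≤ T.thick X := fun _ h _ _ hX => hX _ h

theorem thick_le {X P : ObjectProperty C} (hP : T.IsThick P) (h : X ≤ P) : T.thick X ≤ P :=
  fun _ hZ => hZ P hP h

variable [HasZeroObject C]

open scoped ZeroObject

theorem ClosedUnderSummands.of_iso (hX : ClosedUnderSummands X) {A B : C} (e : A ≅ B) (h : X B) :
    X A :=
  hX ⟨(isoBiprodZero (isZero_zero C)).symm ≪≫ e⟩ h

theorem ClosedUnderSummands.zero (hX : ClosedUnderSummands X) {A : C} (h : X A) : X (0 : C) :=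
  hX ⟨(isoZeroBiprod (isZero_zero C)).symm⟩ h

theorem ClosedUnderSummands.isoClosure (hX : ClosedUnderSummands X) {A : C}
    (h : X.isoClosure A) : X A := by
  obtain ⟨B, hB, ⟨e⟩⟩ := h
  exact hX.of_iso e hB

end Closure

/-! ### From cotorsion pairs to AB contexts -/

namespace HigherExtensions

variable {C : Type u} [Category.{v} C] [Preadditive C] [HasZeroObject C] [HasBinaryBiproducts C]
  {T : Extriangulation.{w} C} (H : T.HigherExtensions)

/-- The relation `𝔼^{k+1}(X, Y) = 0`. -/
abbrev vanishes (k : ℕ) : C → C → Prop := H.ExtVanishes (k + 1)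

theorem relInjDim_eq_zero_iff (X Y : ObjectProperty C) :
    H.relInjDim X Y = 0 ↔ Y ≤ rightPerp H.vanishes X := by
  simp only [relInjDim, ← bot_eq_zero, iSup_eq_bot]
  simp only [bot_eq_zero, relInjDimObj]
  refine forall_congr' fun B => forall_congr' fun _ => ⟨fun h => ?_, fun h => ?_⟩
  -- An empty set of bounds would have infimum ⊤, so the set is nonempty and its infimum 0 is
  -- attained.
  · have hne : {d : ℕ∞ | ∃ m : ℕ, d = m ∧ ∀ k : ℕ, m + 1 ≤ k → ∀ A : C, X A →
        H.ExtVanishes k A B}.Nonempty := by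
      by_contra hne
      rw [Set.not_nonempty_iff_eq_empty.1 hne, sInf_empty] at h
      exact ENat.top_ne_zero h
    obtain ⟨m, hm, hk⟩ := h ▸ csInf_mem hne
    obtain rfl : m = 0 := by exact_mod_cast hm.symm
    exact fun A hA k => hk (k + 1) (by omega) A hA
  · refine le_antisymm (sInf_le ⟨0, rfl, fun k hk A hA => ?_⟩) zero_le
    obtain ⟨k, rfl⟩ := Nat.exists_eq_add_of_le' hk
    exact h hA k

theorem relProjDim_eq_zero_iff (X Y : ObjectProperty C) :
    H.relProjDim X Y = 0 ↔ Y ≤ leftPerp H.vanishes X := by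
  simp only [relProjDim, ← bot_eq_zero, iSup_eq_bot]
  simp only [bot_eq_zero, relProjDimObj]
  refine forall_congr' fun B => forall_congr' fun _ => ⟨fun h => ?_, fun h => ?_⟩
  · have hne : {d : ℕ∞ | ∃ m : ℕ, d = m ∧ ∀ k : ℕ, m + 1 ≤ k → ∀ A : C, X A →
        H.ExtVanishes k B A}.Nonempty := by
      by_contra hne
      rw [Set.not_nonempty_iff_eq_empty.1 hne, sInf_empty] at h
      exact ENat.top_ne_zero h
    obtain ⟨m, hm, hk⟩ := h ▸ csInf_mem hne
    obtain rfl : m = 0 := by exact_mod_cast hm.symm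
    exact fun A hA k => hk (k + 1) (by omega) A hA
  · refine le_antisymm (sInf_le ⟨0, rfl, fun k hk A hA => ?_⟩) zero_le
    obtain ⟨k, rfl⟩ := Nat.exists_eq_add_of_le' hk
    exact h hA k

variable {H} {S F G : ObjectProperty C}

namespace MemPTilde

theorem exists_left (h : H.MemPTilde S F G) {Z : C} (hZ : T.thick F Z) :
    ∃ K M : C, F M ∧ G K ∧ T.HasConflation K M Z := by
  obtain ⟨K, M, hM, ⟨m, hm, hK⟩, hc⟩ := h.cotorsion.1.complete Z hZ
  obtain rfl : m = 0 := by omega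
  exact ⟨K, M, hM, h.cotorsion.2.summands.isoClosure hK, hc⟩

theorem exists_right (h : H.MemPTilde S F G) {Z : C} (hZ : T.thick F Z) :
    ∃ M K : C, G M ∧ F K ∧ T.HasConflation Z M K := by
  obtain ⟨M, K, hM, ⟨m, hm, hK⟩, hc⟩ := h.cotorsion.2.complete Z hZ
  obtain rfl : m = 0 := by omega
  exact ⟨M, K, hM, h.cotorsion.1.summands.isoClosure hK, hc⟩

theorem vanishes (h : H.MemPTilde S F G) {X Y : C} (hX : F X) (hY : G Y) (k : ℕ) :
    H.vanishes k X Y :=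
  (H.relInjDim_eq_zero_iff F G).1 h.injective Y hY hX k

/-- An object of Thick(F) left orthogonal to G splits off its F-approximation, whose kernel lies in
G. -/
theorem eq_leftPerp (h : H.MemPTilde S F G) : F = leftPerp H.vanishes G ⊓ T.thick F := by
  refine le_antisymm
    (fun X hX => ⟨fun Y hY => h.vanishes hX hY, Extriangulation.le_thick F X hX⟩) ?_
  · rintro X ⟨hX, hX'⟩
    obtain ⟨K, M, hM, hK, hc⟩ := h.exists_left hX'
    obtain ⟨e⟩ := H.vanishingTheory.split hc (hX hK 0)
    exact h.cotorsion.1.summands ⟨biprod.braiding X K ≪≫ e⟩ hM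

theorem eq_rightPerp (h : H.MemPTilde S F G) : G = rightPerp H.vanishes F ⊓ T.thick F := by
  refine le_antisymm (fun X hX => ⟨fun Y hY => h.vanishes hY hX, h.le_thick X hX⟩) ?_
  · rintro X ⟨hX, hX'⟩
    obtain ⟨M, K, hM, hK, hc⟩ := h.exists_right hX'
    obtain ⟨e⟩ := H.vanishingTheory.split hc (hX hK 0)
    exact h.cotorsion.2.summands ⟨e⟩ hM

theorem isLeftThick (h : H.MemPTilde S F G) : T.IsLeftThick F := by
  rw [h.eq_leftPerp]
  exact (H.vanishingTheory.isLeftThick_leftPerp G).inf (isThick_thick F).1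

theorem isRightThick (h : H.MemPTilde S F G) : T.IsRightThick G := by
  rw [h.eq_rightPerp]
  exact (H.vanishingTheory.isRightThick_rightPerp F).inf (isThick_thick F).2

/-- Induction on the degree from which the extensions of X into G vanish. At 0 the object is left
orthogonal to G, hence in F. Otherwise X is covered by an object of F ∩ G ∩ S, and the kernel stays
in G ∩ S with a bound smaller by one. -/
theorem finResDim (h : H.MemPTilde S F G) (hS : T.IsThick S) (n : ℕ) {X : C} (hX : G X)
    (hX' : S X) (hn : ∀ ⦃Y : C⦄, G Y → ∀ k : ℕ, n ≤ k → H.vanishes k X Y) :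
    T.finResDim (F ⊓ S) X := by
  induction n generalizing X with
  | zero =>
    refine ⟨0, 0, le_rfl, X, ⟨?_, hX'⟩, ⟨Iso.refl X⟩⟩
    rw [h.eq_leftPerp]
    exact ⟨fun Y hY k => hn hY k (Nat.zero_le k), h.le_thick X hX⟩
  | succ n ih =>
    obtain ⟨K, M, hM, hK, hc⟩ := h.exists_left (h.le_thick X hX)
    -- The approximation M lies in F ∩ G but perhaps not in S; the relative generator replaces it by
    -- W in S.
    obtain ⟨L, W, hL, hW, hc'⟩ := h.generator.2 M ⟨hM, h.isRightThick.extensions hc hK hX⟩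
    obtain ⟨N, hN, hN'⟩ := hc'.comp_deflation hc
    obtain ⟨-, m, -, hm⟩ := ih (h.isRightThick.extensions hN' hL.2 hK)
      (hS.1.cocones _ ⟨_, _, hW.2, hX', hN⟩) fun Y hY k hk => H.vanishingTheory.cocone_left hN
        (h.vanishes hW.1.1 hY k) (hn hY (k + 1) (by omega))
    exact ⟨m + 1, m + 1, le_rfl, N, W, hm, ⟨hW.1.1, hW.2⟩, hN⟩

theorem isLeftWeakABContextCut (h : H.MemPTilde S F G) (hS : T.IsThick S) :
    H.IsLeftWeakABContextCut S F G where
  frobenius :=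
    { leftThick := h.isLeftThick
      frobenius :=
        { leftThick := h.isLeftThick.inf hS.1
          summands := (h.isLeftThick.summands.inf h.isRightThick.summands).inf hS.1.summands
          injective := (H.relInjDim_eq_zero_iff _ _).2 fun Y hY X hX =>
            h.vanishes hX.1 hY.1.2
          cogenerator := by
            refine ⟨fun X hX => ⟨hX.1.1, hX.2⟩, fun X hX => ?_⟩
            obtain ⟨M, K, hM, hK, hc⟩ := h.exists_right (Extriangulation.le_thick F X hX.1)
            obtain ⟨W, L, hW, hL, hc'⟩ :=
              h.cogenerator.2 M ⟨h.isLeftThick.extensions hc hX.1 hK, hM⟩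
            obtain ⟨N, hN, hN'⟩ := hc.comp_inflation hc'
            exact ⟨W, N, hW, ⟨h.isLeftThick.extensions hN' hK hL.1,
              hS.2.cones _ ⟨_, _, hX.2, hW.2, hN⟩⟩, hN⟩ }
      projective := (H.relProjDim_eq_zero_iff _ _).2 fun X hX Y hY =>
        h.vanishes hX.1.1 hY.2
      generator := h.generator
      extensions := ClosedUnderExtensions.inf h.isLeftThick.extensions h.isRightThick.extensions
      summands := h.isLeftThick.summands.inf h.isRightThick.summands }
  rightThick := h.isRightThick.inf hS.2
  le_finResDim := by
    rintro X ⟨hX, hX'⟩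
    -- The objects whose extensions into G vanish in high degrees form a thick class containing F,
    -- hence containing G ≤ Thick(F). This supplies the bound for the induction.
    obtain ⟨n, hn⟩ := thick_le (H.vanishingTheory.isThick_boundedPerp G)
      (fun Z hZ => ⟨0, fun Y hY k _ => h.vanishes hZ hY k⟩) X (h.le_thick X hX)
    exact h.finResDim hS n hX hX' hn

end MemPTilde

end HigherExtensions

end Extriangulation

namespace Extriangulation

/-! ### The thick class generated by a left Frobenius pair -/

section RightThickClosure

variable {C : Type u} [Category.{v} C] [Preadditive C] [HasBinaryBiproducts C]

/-- The smallest right thick class containing `X`. -/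
def rightThickClosure (T : Extriangulation.{w} C) (X : ObjectProperty C) : ObjectProperty C :=
  fun Z => ∀ P : ObjectProperty C, T.IsRightThick P → X ≤ P → P Z

variable {T : Extriangulation.{w} C}

theorem isRightThick_rightThickClosure (X : ObjectProperty C) :
    T.IsRightThick (T.rightThickClosure X) where
  extensions := fun _ _ _ h hA hZ P hP hX => hP.extensions h (hA P hP hX) (hZ P hP hX)
  summands := fun _ _ _ e h P hP hX => hP.summands e (h P hP hX)
  cones := fun _ ⟨_, _, hA, hB, h⟩ P hP hX => hP.cones _ ⟨_, _, hA P hP hX, hB P hP hX, h⟩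

theorem le_rightThickClosure (X : ObjectProperty C) : X ≤ T.rightThickClosure X :=
  fun _ h _ _ hX => hX _ h

theorem rightThickClosure_le {X P : ObjectProperty C} (hP : T.IsRightThick P) (h : X ≤ P) :
    T.rightThickClosure X ≤ P :=
  fun _ hZ => hZ P hP h

end RightThickClosure

namespace HigherExtensions

variable {C : Type u} [Category.{v} C] [Preadditive C] [HasZeroObject C] [HasBinaryBiproducts C]
  {T : Extriangulation.{w} C} {H : T.HigherExtensions}

open scoped ZeroObject

namespace IsLeftFrobenius

variable {F ω : ObjectProperty C}

theorem le_rightPerp (h : H.IsLeftFrobenius F ω) : ω ≤ rightPerp H.vanishes F :=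
  (H.relInjDim_eq_zero_iff F ω).1 h.injective

theorem rightThickClosure_le_rightPerp (h : H.IsLeftFrobenius F ω) :
    T.rightThickClosure ω ≤ rightPerp H.vanishes F :=
  rightThickClosure_le (H.vanishingTheory.isRightThick_rightPerp F) h.le_rightPerp

/-- Closure under sums is not part of the definition: the embedding of A ⊞ B into an object of ω
with cokernel in F splits, so A ⊞ B is a summand of that object. -/
theorem biprod_mem (h : H.IsLeftFrobenius F ω) {A B : C} (hA : ω A) (hB : ω B) : ω (A ⊞ B) := by
  obtain ⟨W, Z, hW, hZ, hc⟩ := h.cogenerator.2 (A ⊞ B)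
    (h.leftThick.extensions (hasConflation_biprod A B) (h.cogenerator.1 A hA)
      (h.cogenerator.1 B hB))
  obtain ⟨e⟩ := H.vanishingTheory.split hc ((H.vanishingTheory.isRightThick_rightPerp F).extensions
    (hasConflation_biprod A B) (h.le_rightPerp A hA) (h.le_rightPerp B hB) hZ 0)
  exact h.summands ⟨e⟩ hW

theorem exists_cover (h : H.IsLeftFrobenius F ω) {Y : C} (hY : T.rightThickClosure ω Y) :
    ∃ L W : C, T.rightThickClosure ω L ∧ ω W ∧ T.HasConflation L W Y := by
  have hR := isRightThick_rightThickClosure (T := T) ω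
  have hωR := le_rightThickClosure (T := T) ω
  refine (rightThickClosure_le (P := fun Y => T.rightThickClosure ω Y ∧
    ∃ L W : C, T.rightThickClosure ω L ∧ ω W ∧ T.HasConflation L W Y) ⟨?_, ?_, ?_⟩ ?_ Y hY).2
  · rintro A B Z hc ⟨hA, L₁, W₁, hL₁, hW₁, hc₁⟩ ⟨hZ, L₂, W₂, hL₂, hW₂, hc₂⟩
    refine ⟨hR.extensions hc hA hZ, ?_⟩
    -- A horseshoe: the pullback P of B along W₂ → Z splits as A ⊞ W₂, so W₁ ⊞ W₂ covers P and then
    -- B.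
    obtain ⟨P, hP, hP'⟩ := hc.pullback hc₂
    obtain ⟨e⟩ := H.vanishingTheory.split hP
      (h.rightThickClosure_le_rightPerp A hA (h.cogenerator.1 _ hW₂) 0)
    have hc₃ := (hc₁.biprod (hasConflation_zero_left W₂)).of_iso
      (isoBiprodZero (isZero_zero C)).symm (Iso.refl _) e
    obtain ⟨N, hN, hN'⟩ := hc₃.comp_deflation hP'
    exact ⟨N, W₁ ⊞ W₂, hR.extensions hN' hL₁ hL₂, h.biprod_mem hW₁ hW₂, hN⟩
  · rintro A B Z ⟨e⟩ ⟨hZ, L, W, hL, hW, hc⟩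
    refine ⟨hR.summands ⟨e⟩ hZ, ?_⟩
    obtain ⟨N, hN, hN'⟩ := (hc.of_iso (Iso.refl _) (Iso.refl _) e.symm).comp_deflation
      (hasConflation_biprod' A B)
    exact ⟨N, W, hR.extensions hN' hL (hR.summands ⟨biprod.braiding B A ≪≫ e⟩ hZ), hW, hN⟩
  · rintro Z ⟨A, B, ⟨hA, -⟩, ⟨hB, L, W, hL, hW, hc⟩, hc'⟩
    refine ⟨hR.cones _ ⟨A, B, hA, hB, hc'⟩, ?_⟩
    obtain ⟨N, hN, hN'⟩ := hc.comp_deflation hc'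
    exact ⟨N, W, hR.extensions hN' hL hA, hW, hN⟩
  · exact fun W hW => ⟨hωR W hW, 0, W, hωR _ (h.summands.zero hW), hW, hasConflation_zero_left W⟩

/-- From Z → Y → M, cover Y by W ∈ ω; the kernel of W → M lies in F and maps onto Z. From Y → M → Z,
embed M into W ∈ ω; the cokernel of Y → W lies in the right thick closure and contains Z. -/
theorem cocone_iff_cone (h : H.IsLeftFrobenius F ω) (Z : C) :
    T.cocone (T.rightThickClosure ω) F Z ↔ T.cone (T.rightThickClosure ω) F Z := by
  constructor
  · rintro ⟨Y, M, hY, hM, hc⟩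
    obtain ⟨L, W, hL, hW, hc'⟩ := h.exists_cover hY
    obtain ⟨N, hN, hN'⟩ := hc'.comp_deflation hc
    exact ⟨L, N, hL, h.leftThick.cocones _ ⟨_, _, h.cogenerator.1 W hW, hM, hN⟩, hN'⟩
  · rintro ⟨Y, M, hY, hM, hc⟩
    obtain ⟨W, L, hW, hL, hc'⟩ := h.cogenerator.2 M hM
    obtain ⟨N, hN, hN'⟩ := hc.comp_inflation hc'
    exact ⟨N, L, (isRightThick_rightThickClosure ω).cones _
      ⟨_, _, hY, le_rightThickClosure ω W hW, hN⟩, hL, hN'⟩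

theorem le_cocone (h : H.IsLeftFrobenius F ω) : F ≤ T.cocone (T.rightThickClosure ω) F := by
  intro M hM
  obtain ⟨W, L, hW, hL, hc⟩ := h.cogenerator.2 M hM
  exact ⟨W, L, le_rightThickClosure ω W hW, hL, hc⟩

theorem cocone_of_conflation (h : H.IsLeftFrobenius F ω) {A B Z : C} (hc : T.HasConflation A B Z)
    (hB : T.cocone (T.rightThickClosure ω) F B) (hZ : F Z) :
    T.cocone (T.rightThickClosure ω) F A := by
  obtain ⟨Y, M, hY, hM, hc'⟩ := hB
  obtain ⟨N, hN, hN'⟩ := hc.comp_inflation hc'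
  exact ⟨Y, N, hY, h.leftThick.extensions hN' hZ hM, hN⟩

theorem cocone_extensions (h : H.IsLeftFrobenius F ω) :
    T.ClosedUnderExtensions (T.cocone (T.rightThickClosure ω) F) := by
  intro A B Z hc hA hZ
  have hR := isRightThick_rightThickClosure (T := T) ω
  obtain ⟨Y₁, M₁, hY₁, hM₁, hc₁⟩ := hA
  obtain ⟨Y₂, M₂, hY₂, hM₂, hc₂⟩ := (h.cocone_iff_cone Z).1 hZ
  -- Pushing out replaces A by Y₁, and pulling P back along M₂ → Z then gives Q ≅ Y₁ ⊞ M₂. Embedding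
  -- M₂ into W ∈ ω presents P as the kernel of a deflation N → L with N in the closure and L ∈ F,
  -- and B is the kernel of P → M₁.
  obtain ⟨P, hP, hP'⟩ := hc.pushout hc₁
  obtain ⟨Q, hQ, hQ'⟩ := hP.pullback hc₂
  refine h.cocone_of_conflation hP' ?_ hM₁
  obtain ⟨e⟩ := H.vanishingTheory.split hQ (h.rightThickClosure_le_rightPerp Y₁ hY₁ hM₂ 0)
  obtain ⟨W, L, hW, hL, hc₃⟩ := h.cogenerator.2 M₂ hM₂
  have hc₄ := ((hasConflation_zero_right Y₁).biprod hc₃).of_iso e (Iso.refl _)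
    (isoZeroBiprod (isZero_zero C)).symm
  obtain ⟨N, hN, hN'⟩ := hQ'.comp_inflation hc₄
  exact ⟨N, L, hR.cones _ ⟨_, _, hY₂, hR.extensions (hasConflation_biprod Y₁ W) hY₁
    (le_rightThickClosure ω W hW), hN⟩, hL, hN'⟩

theorem cocone_cones (h : H.IsLeftFrobenius F ω) :
    T.ClosedUnderCones (T.cocone (T.rightThickClosure ω) F) := by
  rintro Z ⟨A, B, ⟨Y, M, hY, hM, hc⟩, hB, hc'⟩
  obtain ⟨P, hP, hP'⟩ := hc'.pushout hc
  obtain ⟨Y', M', hY', hM', hc''⟩ := h.cocone_extensions hP' hB (h.le_cocone M hM)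
  obtain ⟨N, hN, hN'⟩ := hP.comp_inflation hc''
  exact ⟨N, M', (isRightThick_rightThickClosure ω).cones _ ⟨_, _, hY, hY', hN⟩, hM', hN'⟩

theorem cocone_cocones (h : H.IsLeftFrobenius F ω) :
    T.ClosedUnderCocones (T.cocone (T.rightThickClosure ω) F) := by
  rintro A ⟨B, Z, hB, hZ, hc⟩
  obtain ⟨Y, M, hY, hM, hc'⟩ := (h.cocone_iff_cone Z).1 hZ
  obtain ⟨P, hP, hP'⟩ := hc.pullback hc'
  exact h.cocone_of_conflation hP (h.cocone_extensions hP'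
    ⟨Y, 0, hY, h.leftThick.summands.zero hM, hasConflation_zero_right Y⟩ hB) hM

theorem cocone_le_boundedPerp (h : H.IsLeftFrobenius F ω) :
    T.cocone (T.rightThickClosure ω) F ≤ boundedPerp H.vanishes (T.rightThickClosure ω) := by
  have hF : F ≤ boundedPerp H.vanishes (T.rightThickClosure ω) := fun M hM =>
    ⟨0, fun Y hY k _ => h.rightThickClosure_le_rightPerp Y hY hM k⟩
  have ht := H.vanishingTheory.isThick_boundedPerp (T.rightThickClosure ω)
  rintro Z ⟨Y, M, hY, hM, hc⟩
  exact ht.1.cocones _ ⟨Y, M, rightThickClosure_le ht.2 (h.cogenerator.1.trans hF) Y hY,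
    hF M hM, hc⟩

/-- Closure under summands, by induction on a bound for the extensions into the closure. At 0 the
cover M of Z ⊞ Z' splits, so Z is a summand of M. Otherwise, let K and K' be the kernels of M → Z
and M → Z'. Then K ⊞ K' lies in the class and has a smaller bound, so K lies in the class, and so
does Z as a cone of K → M. -/
theorem cocone_of_biprod (h : H.IsLeftFrobenius F ω) (n : ℕ) {Z Z' : C}
    (hZ : T.cocone (T.rightThickClosure ω) F (Z ⊞ Z'))
    (hn : ∀ ⦃Y : C⦄, T.rightThickClosure ω Y → ∀ k : ℕ, n ≤ k → H.vanishes k (Z ⊞ Z') Y) :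
    T.cocone (T.rightThickClosure ω) F Z := by
  obtain ⟨Y, M, hY, hM, hc⟩ := (h.cocone_iff_cone _).1 hZ
  induction n generalizing Z Z' Y M with
  | zero =>
    obtain ⟨e⟩ := H.vanishingTheory.split hc (hn hY 0 le_rfl)
    exact h.le_cocone Z (h.leftThick.summands ⟨Iso.refl _⟩
      (h.leftThick.summands ⟨biprod.braiding (Z ⊞ Z') Y ≪≫ e⟩ hM))
  | succ n ih =>
    obtain ⟨K, hK, -⟩ := hc.comp_deflation (hasConflation_biprod' Z Z')
    obtain ⟨K', hK', -⟩ := hc.comp_deflation (hasConflation_biprod Z Z')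
    have hMM : F (M ⊞ M) := h.leftThick.extensions (hasConflation_biprod M M) hM hM
    have hKK := hK.biprod hK'
    have hD := h.cocone_cocones _ ⟨_, _, h.le_cocone _ hMM, hZ, hKK⟩
    obtain ⟨Y', M', hY', hM', hc'⟩ := (h.cocone_iff_cone _).1 hD
    refine h.cocone_cones _ ⟨K, M, ih hD (fun Y hY k hk => ?_) Y' M' hY' hM' hc',
      h.le_cocone M hM, hK⟩
    exact H.vanishingTheory.cocone_left hKK (h.rightThickClosure_le_rightPerp Y hY hMM k)
      (hn hY (k + 1) (by omega))

theorem isThick_cocone (h : H.IsLeftFrobenius F ω) :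
    T.IsThick (T.cocone (T.rightThickClosure ω) F) := by
  have hsum : ClosedUnderSummands (T.cocone (T.rightThickClosure ω) F) := by
    rintro A B Z ⟨e⟩ ⟨Y, M, hY, hM, hc⟩
    have hD : T.cocone (T.rightThickClosure ω) F (A ⊞ B) :=
      ⟨Y, M, hY, hM, hc.of_iso e.symm (Iso.refl _) (Iso.refl _)⟩
    obtain ⟨n, hn⟩ := h.cocone_le_boundedPerp _ hD
    exact h.cocone_of_biprod n hD hn
  exact ⟨⟨h.cocone_extensions, hsum, h.cocone_cocones⟩, ⟨h.cocone_extensions, hsum, h.cocone_cones⟩⟩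

end IsLeftFrobenius

/-! ### From AB contexts to cotorsion pairs -/

theorem finResDim_le {F P : ObjectProperty C} (hP : T.IsRightThick P) (h : F ≤ P) :
    T.finResDim F ≤ P := by
  rintro Z ⟨-, n, -, hZ⟩
  induction n generalizing Z with
  | zero =>
    obtain ⟨M, hM, ⟨e⟩⟩ := hZ
    exact hP.summands.of_iso e (h M hM)
  | succ n ih =>
    obtain ⟨K, M, hK, hM, hc⟩ := hZ
    exact hP.cones _ ⟨K, M, ih K hK, h M hM, hc⟩

theorem IsLeftWeakABContextCut.memPTilde {S A B : ObjectProperty C}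
    (h : H.IsLeftWeakABContextCut S A B) : H.MemPTilde S (A ⊓ S) (B ⊓ S) := by
  have hF := h.frobenius.frobenius
  have hR : T.rightThickClosure (A ⊓ B ⊓ S) ≤ B ⊓ S :=
    rightThickClosure_le h.rightThick fun X hX => ⟨hX.1.2, hX.2⟩
  -- A finite resolution puts X in the thick class, giving Y → M → X. Both ends lie in B ∩ S, hence
  -- so does M, which is therefore in A ∩ B ∩ S; thus X is a cone of objects of the closure.
  have hG : B ⊓ S ≤ T.rightThickClosure (A ⊓ B ⊓ S) := by
    intro X hX
    obtain ⟨Y, M, hY, hM, hc⟩ := (hF.cocone_iff_cone X).1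
      (finResDim_le hF.isThick_cocone.2 hF.le_cocone X (h.le_finResDim X hX))
    refine (isRightThick_rightThickClosure _).cones _ ⟨Y, M, hY, le_rightThickClosure _ M
      ⟨⟨hM.1, (h.rightThick.extensions hc (hR Y hY) hX).1⟩, hM.2⟩, hc⟩
  have hD := thick_le hF.isThick_cocone hF.le_cocone
  have hv {X Y : C} (hX : (A ⊓ S) X) (hY : (B ⊓ S) Y) (k : ℕ) : H.vanishes k X Y :=
    hF.rightThickClosure_le_rightPerp Y (hG Y hY) hX k
  refine ⟨⟨⟨⟨hF.leftThick.summands, ?_, ?_⟩, ⟨h.rightThick.summands, ?_, ?_⟩⟩, ?_, ?_, ?_⟩, ?_⟩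
  · intro i hi hi' X Y hX hY
    obtain rfl := le_antisymm hi' hi
    exact hv hX.1 hY 0
  · intro Z hZ
    obtain ⟨Y, M, hY, hM, hc⟩ := (hF.cocone_iff_cone Z).1 (hD Z hZ)
    exact ⟨Y, M, hM, ⟨0, le_rfl, Y, hR Y hY, ⟨Iso.refl Y⟩⟩, hc⟩
  · intro i hi hi' X Y hX hY
    obtain rfl := le_antisymm hi' hi
    exact hv hX hY.1 0
  · intro Z hZ
    obtain ⟨Y, M, hY, hM, hc⟩ := hD Z hZ
    exact ⟨Y, M, hR Y hY, ⟨0, le_rfl, M, hM, ⟨Iso.refl M⟩⟩, hc⟩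
  · exact (H.relInjDim_eq_zero_iff _ _).2 fun Y hY X hX => hv hX hY
  -- Both classes already lie in S, so the trivial conflations 0 → X → X and, below, X → X → 0
  -- suffice.
  · exact ⟨inf_le_left, fun X hX => ⟨0, X, (hF.leftThick.summands.inf h.rightThick.summands).zero hX,
      ⟨hX, hX.1.2⟩, hasConflation_zero_left X⟩⟩
  · exact ⟨inf_le_left, fun X hX => ⟨X, 0, ⟨hX, hX.1.2⟩,
      (hF.leftThick.summands.inf h.rightThick.summands).zero hX, hasConflation_zero_right X⟩⟩
  · exact hG.trans (rightThickClosure_le (isThick_thick _).2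
      (hF.cogenerator.1.trans (le_thick _)))

end HigherExtensions

end Extriangulation

/-! ### The bijection of equivalence classes -/

theorem corollary5p6 {C : Type u} [Category.{v} C] [Preadditive C] [HasZeroObject C]
    [HasBinaryBiproducts C] (T : Extriangulation.{w} C) (H : T.HigherExtensions)
    (S : ObjectProperty C) (hS : T.IsThick S) :
    ∃ Λ : Quotient (Extriangulation.HigherExtensions.PTilde.setoid H S) ≃
        Quotient (Extriangulation.HigherExtensions.ABContext.setoid H S),
      (∀ (F G : ObjectProperty C) (h : H.MemPTilde S F G),
        ∃ h' : H.IsLeftWeakABContextCut S F G,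
          Λ (Extriangulation.HigherExtensions.PTilde.cls H h) =
            Extriangulation.HigherExtensions.ABContext.cls H h') ∧
      (∀ (A B : ObjectProperty C) (h : H.IsLeftWeakABContextCut S A B),
        ∃ h' : H.MemPTilde S (A ⊓ S) (B ⊓ S),
          Λ.symm (Extriangulation.HigherExtensions.ABContext.cls H h) =
            Extriangulation.HigherExtensions.PTilde.cls H h') := by
  -- Every pair is equivalent to its intersection with `S`; this gives well-definedness of the
  -- inverse and both inverse laws.
  have hinf (A B : ObjectProperty C) : A ⊓ S ⊓ S = A ⊓ S ∧ A ⊓ S ⊓ (B ⊓ S) ⊓ S = A ⊓ B ⊓ S :=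
    ⟨by rw [inf_assoc, inf_idem], by rw [← inf_inf_distrib_right, inf_assoc, inf_idem]⟩
  refine ⟨⟨Quotient.map (fun p => ⟨p.1, p.2.isLeftWeakABContextCut hS⟩) fun _ _ h => h,
    Quotient.map (fun p => ⟨(p.1.1 ⊓ S, p.1.2 ⊓ S), p.2.memPTilde⟩) ?_, ?_, ?_⟩,
    fun F G h => ⟨h.isLeftWeakABContextCut hS, rfl⟩, fun A B h => ⟨h.memPTilde, rfl⟩⟩
  · rintro ⟨⟨A, B⟩, -⟩ ⟨⟨A', B'⟩, -⟩ (h : A ⊓ S = A' ⊓ S ∧ A ⊓ B ⊓ S = A' ⊓ B' ⊓ S)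
    exact ⟨(hinf A B).1.trans (h.1.trans (hinf A' B').1.symm),
      (hinf A B).2.trans (h.2.trans (hinf A' B').2.symm)⟩
  · rintro ⟨⟨⟨F, G⟩, -⟩⟩
    exact Quotient.sound (hinf F G)
  · rintro ⟨⟨⟨A, B⟩, -⟩⟩
    exact Quotient.sound (hinf A B)
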